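/- Let $\mathcal{O}_K$ be a principal ideal domain with field of fractions $K$, let $n_1,\dots,n_k$ be positive integers, and put $n=\mathrm{lcm}(n_1,\dots,n_k)$; assume that the characteristic of $K$ is coprime to $n$. Let $a_1,\dots,a_k\in\mathcal{O}_K$ be non-zero, and for each $i$ let $\alpha_i=\sqrt[n_i]{a_i}$ be a root of $x^{n_i}-a_i$, which is assumed to be irreducible over $K$; all fields are taken inside a fixed Galois extension $\Omega/K$ containing the $\alpha_i$ (for example a separable closure of $K$). Let $L_i=K(\alpha_i)$ and $L=K(\alpha_1,\dots,\alpha_k)$, and write $\mathcal{O}_F$ for the integral closure of $\mathcal{O}_K$ in a field $F$ and $\zeta_m$ for a primitive $m$-th root of unity. Terminology. For a finite separable extension $F/K$ with normal closure $\widetilde F$, a Galois complement of $F/K$ is a Galois extension $M/K$ that is $K$-linearly disjoint from $F$ and satisfies $FM=\widetilde F$. Put $G=\mathrm{Gal}(\widetilde F/K)$, $G'=\mathrm{Gal}(\widetilde F/F)$, $X=G/G'$, $J=\mathrm{Gal}(\widetilde F/M)$, let $\lambda\colon G\to\mathrm{Perm}(X)$ be left translation, and let $N$ be the centralizer of $\lambda(J)$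 in $\mathrm{Perm}(X)$. The almost classically Galois structure on $F/K$ corresponding to $M$ is the $K$-algebra $H=\widetilde F[N]^G$ ($G$ acting on $\widetilde F$ by evaluation and on $N$ by conjugation through $\lambda$), which acts on $F$ by $\big(\sum_\eta h_\eta\eta\big)\cdot x=\sum_\eta h_\eta\,\eta^{-1}(1\,G')(x)$. Its associated order is $\mathfrak{A}_H=\{h\in H: h\cdot\mathcal{O}_F\subseteq\mathcal{O}_F\}$. The extension $F/K$ is almost Kummer with respect to $n$, with complement $M$, if $J$ is abelian of exponent dividing $n$. Assume that: 1. $L_i\cap K(\zeta_{n_i})=K$ for every $i$, and $L\cap K(\zeta_n)=K$; 2. the $L_i/K$ are pairwise strongly disjoint: for $i\neq j$, $L_i$ and $L_j$ are $K$-linearly disjoint and $L_i\cap K(\zeta_{n_j})=L_j\cap K(\zeta_{n_i})=K$; moreover, if the integers $n_1,\dots,n_k$ are not pairwise coprime, then $[L:K]=n_1\cdots n_k$ (this equality is automatic if they are pairwise coprime); 3. the elements $a_1n_1,\dots,a_kn_k$ of $\mathcal{O}_K$ are pairwise coprime; 4. $\mathcal{O}_{L_i}=\mathcal{O}_K[\alpha_i]$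 for every $i$. Then $K(\zeta_{n_i})$ is a Galois complement of $L_i/K$ for every $i$, $K(\zeta_n)$ is a Galois complement of $L/K$, and $L/K$ is almost Kummer with respect to $n$ with complement $K(\zeta_n)$. Let $H_i$ and $H$ be the almost classically Galois structures on $L_i/K$ and $L/K$ corresponding to $K(\zeta_{n_i})$ and $K(\zeta_n)$. Then there is an isomorphism of $K$-algebras $\bigotimes_{i=1}^k H_i\cong H$ such that $(h_1\otimes\cdots\otimes h_k)\cdot(x_1\cdots x_k)=(h_1\cdot x_1)\cdots(h_k\cdot x_k)$ for all $h_i\in H_i$ and $x_i\in L_i$; under this identification $\mathfrak{A}_H=\bigotimes_{i=1}^k\mathfrak{A}_{H_i}$ (tensor product over $\mathcal{O}_K$), and $\mathcal{O}_L$ is a free $\mathfrak{A}_H$-module. -/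

import Mathlib

open scoped TensorProduct

noncomputable section

namespace HopfGalois

/-! ### Hopf-Galois structures in the Greither-Pareigis description

`L / K` is an extension of fields and `E / K` is its normal closure, with `G = Gal(E/K)`,
`G' = Gal(E/L)`, `X = G / G'`. -/

section GreitherPareigis

variable (K L E : Type*) [Field K] [Field L] [Field E] [Algebra K L] [Algebra K E] [Algebra L E]
  [IsScalarTower K L E]

/-- `G' = Gal(E/L)` as a subgroup of `G = Gal(E/K)`. -/
def galSub : Subgroup (E ≃ₐ[K] E) :=
  (IsScalarTower.toAlgHom K L E).fieldRange.fixingSubgroup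

/-- The set `X = G / G'` of left cosets. -/
abbrev Cosets : Type _ := (E ≃ₐ[K] E) ⧸ galSub K L E

/-- The left translation map `G → Perm(X)`, `g ↦ (h G' ↦ g h G')`. -/
def leftTrans : (E ≃ₐ[K] E) →* Equiv.Perm (Cosets K L E) :=
  MulAction.toPermHom (E ≃ₐ[K] E) (Cosets K L E)

/-- The value `g(x) ∈ E` of a coset `g G'` at `x ∈ L`. -/
def cosetEval (t : Cosets K L E) (x : L) : E :=
  Quotient.liftOn' t (fun g => g (algebraMap L E x)) (by
    intro g g' h
    have h2 : g⁻¹ * g' ∈ galSub K L E := QuotientGroup.leftRel_apply.mp h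
    have h3 : (g⁻¹ * g') (algebraMap L E x) = algebraMap L E x :=
      (IntermediateField.mem_fixingSubgroup_iff _ _).mp h2 _ ⟨x, rfl⟩
    have h4 := congrArg g h3
    rw [← AlgEquiv.mul_apply, mul_inv_cancel_left] at h4
    exact h4.symm)

/-- The action of `g ∈ G` on `E[Perm(X)]`: by evaluation on `E` and by conjugation with the left
translation by `g` on `Perm(X)`. -/
def twist (g : E ≃ₐ[K] E) :
    MonoidAlgebra E (Equiv.Perm (Cosets K L E)) →ₐ[K]
      MonoidAlgebra E (Equiv.Perm (Cosets K L E)) :=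
  (MonoidAlgebra.mapAlgHom (Equiv.Perm (Cosets K L E)) (g : E →ₐ[K] E)).comp
    (MonoidAlgebra.mapDomainAlgHom K E (MulAut.conj (leftTrans K L E g)).toMonoidHom)

/-- The `K`-algebra `H = E[N]^G`, for a subgroup `N` of `Perm(X)`. -/
def hopfAlg (N : Subgroup (Equiv.Perm (Cosets K L E))) :
    Subalgebra K (MonoidAlgebra E (Equiv.Perm (Cosets K L E))) :=
  (MonoidAlgebra.mapDomainAlgHom K E N.subtype).range ⊓
    ⨅ g : E ≃ₐ[K] E, AlgHom.equalizer (twist K L E g) (AlgHom.id K _)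

/-- `∑ h_η η⁻¹(t)(x)`, for `h = ∑ h_η η` and a coset `t`. -/
def actAt (h : MonoidAlgebra E (Equiv.Perm (Cosets K L E))) (t : Cosets K L E) (x : L) : E :=
  h.coeff.sum fun η c => c * cosetEval K L E (η⁻¹ t) x

/-- `h · x = ∑ h_η η⁻¹(1 G')(x)`, for `h = ∑ h_η η`, as an element of `E`. -/
def act (h : MonoidAlgebra E (Equiv.Perm (Cosets K L E))) (x : L) : E :=
  actAt K L E h ((1 : E ≃ₐ[K] E) : Cosets K L E) x

variable {K L E}

lemma cosetEval_mk (g : E ≃ₐ[K] E) (x : L) :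
    cosetEval K L E (g : Cosets K L E) x = g (algebraMap L E x) := rfl

lemma cosetEval_add (t : Cosets K L E) (x y : L) :
    cosetEval K L E t (x + y) = cosetEval K L E t x + cosetEval K L E t y := by
  induction t using QuotientGroup.induction_on with
  | H g => simp [cosetEval_mk]

lemma cosetEval_zero (t : Cosets K L E) : cosetEval K L E t 0 = 0 := by
  induction t using QuotientGroup.induction_on with
  | H g => simp [cosetEval_mk]

lemma cosetEval_leftTrans (g : E ≃ₐ[K] E) (t : Cosets K L E) (x : L) :
    cosetEval K L E (leftTrans K L E g t) x = g (cosetEval K L E t x) := by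
  induction t using QuotientGroup.induction_on with
  | H g' => rfl

lemma actAt_zero (t : Cosets K L E) (x : L) : actAt K L E 0 t x = 0 := by
  simp [actAt]

lemma actAt_add (h h' : MonoidAlgebra E (Equiv.Perm (Cosets K L E))) (t : Cosets K L E) (x : L) :
    actAt K L E (h + h') t x = actAt K L E h t x + actAt K L E h' t x := by
  unfold actAt
  rw [MonoidAlgebra.coeff_add, Finsupp.sum_add_index'] <;> intros <;> ring

lemma actAt_single (η : Equiv.Perm (Cosets K L E)) (c : E) (t : Cosets K L E) (x : L) :
    actAt K L E (MonoidAlgebra.single η c) t x = c * cosetEval K L E (η⁻¹ t) x := by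
  unfold actAt
  rw [MonoidAlgebra.coeff_single, Finsupp.sum_single_index]
  ring

lemma actAt_mul_add (h : MonoidAlgebra E (Equiv.Perm (Cosets K L E))) (t : Cosets K L E)
    (x y : L) : actAt K L E h t (x + y) = actAt K L E h t x + actAt K L E h t y := by
  simp only [actAt, cosetEval_add, mul_add, Finsupp.sum_add]

lemma actAt_mul_zero (h : MonoidAlgebra E (Equiv.Perm (Cosets K L E))) (t : Cosets K L E) :
    actAt K L E h t 0 = 0 := by
  simp [actAt, cosetEval_zero]

lemma twist_single (g : E ≃ₐ[K] E) (η : Equiv.Perm (Cosets K L E)) (c : E) :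
    twist K L E g (MonoidAlgebra.single η c) =
      MonoidAlgebra.single (leftTrans K L E g * η * (leftTrans K L E g)⁻¹) (g c) := by
  simp [twist]

lemma map_actAt (g : E ≃ₐ[K] E) (h : MonoidAlgebra E (Equiv.Perm (Cosets K L E)))
    (t : Cosets K L E) (x : L) :
    g (actAt K L E h t x) = actAt K L E (twist K L E g h) (leftTrans K L E g t) x := by
  induction h using MonoidAlgebra.induction_linear with
  | zero => simp [actAt_zero]
  | add a b ha hb => simp only [actAt_add, map_add, ha, hb]
  | single η c =>
    rw [twist_single, actAt_single, actAt_single, map_mul, ← cosetEval_leftTrans]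
    simp [mul_assoc]

lemma twist_eq {N : Subgroup (Equiv.Perm (Cosets K L E))} (h : hopfAlg K L E N)
    (g : E ≃ₐ[K] E) : twist K L E g h = h := by
  have h2 := (Algebra.mem_iInf.mp h.2.2) g
  exact h2

lemma map_act {N : Subgroup (Equiv.Perm (Cosets K L E))} (h : hopfAlg K L E N)
    (g : E ≃ₐ[K] E) (x : L) :
    g (act K L E h x) = actAt K L E h (g : Cosets K L E) x := by
  rw [act, map_actAt, twist_eq]
  have h1 : leftTrans K L E g ((1 : E ≃ₐ[K] E) : Cosets K L E) = (g : Cosets K L E) :=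
    congrArg QuotientGroup.mk (mul_one g)
  rw [h1]

lemma actAt_mul (h h' : MonoidAlgebra E (Equiv.Perm (Cosets K L E))) (t : Cosets K L E) (x : L) :
    actAt K L E (h * h') t x = h.coeff.sum fun η c => c * actAt K L E h' (η⁻¹ t) x := by
  induction h using MonoidAlgebra.induction_linear with
  | zero => simp [actAt_zero]
  | add a b ha hb =>
    rw [add_mul, actAt_add, ha, hb, MonoidAlgebra.coeff_add, Finsupp.sum_add_index'] <;>
      intros <;> ring
  | single η c =>
    rw [MonoidAlgebra.coeff_single, Finsupp.sum_single_index (by ring)]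
    induction h' using MonoidAlgebra.induction_linear with
    | zero => simp [actAt_zero]
    | add a b ha hb => simp only [mul_add, actAt_add, ha, hb]
    | single η' c' =>
      rw [MonoidAlgebra.single_mul_single, actAt_single, actAt_single, mul_inv_rev, mul_assoc]
      rfl

/-- For `h ∈ H` and `x ∈ L`, the element `h · x` lies in `L`. -/
lemma act_mem [IsGalois K E] {N : Subgroup (Equiv.Perm (Cosets K L E))}
    (h : hopfAlg K L E N) (x : L) : ∃ y : L, algebraMap L E y = act K L E h x := by
  have key : act K L E h x ∈ (IsScalarTower.toAlgHom K L E).fieldRange := by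
    rw [← InfiniteGalois.fixedField_fixingSubgroup (IsScalarTower.toAlgHom K L E).fieldRange,
      IntermediateField.mem_fixedField_iff]
    intro g hg
    rw [map_act]
    have : ((g : E ≃ₐ[K] E) : Cosets K L E) = ((1 : E ≃ₐ[K] E) : Cosets K L E) := by
      rw [QuotientGroup.eq]
      simpa using (galSub K L E).inv_mem hg
    rw [this]
    rfl
  obtain ⟨y, hy⟩ := key
  exact ⟨y, hy⟩

/-- The action of `H` on `L`. -/
instance instSMul [IsGalois K E] (N : Subgroup (Equiv.Perm (Cosets K L E))) :
    SMul (hopfAlg K L E N) L where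
  smul h x := (act_mem h x).choose

/-- The defining formula of the action of `H` on `L`. -/
lemma algebraMap_smul [IsGalois K E] {N : Subgroup (Equiv.Perm (Cosets K L E))}
    (h : hopfAlg K L E N) (x : L) : algebraMap L E (h • x) = act K L E h x :=
  (act_mem h x).choose_spec

/-- `L` is a (left) module over the ring `H`. -/
instance instModule [IsGalois K E] (N : Subgroup (Equiv.Perm (Cosets K L E))) :
    Module (hopfAlg K L E N) L where
  one_smul x := by
    apply (algebraMap L E).injective
    rw [algebraMap_smul, act, OneMemClass.coe_one, MonoidAlgebra.one_def, actAt_single]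
    simp [cosetEval_mk]
  mul_smul h h' x := by
    apply (algebraMap L E).injective
    rw [algebraMap_smul, algebraMap_smul, act, act, MulMemClass.coe_mul, actAt_mul]
    unfold actAt
    refine Finsupp.sum_congr fun η _ => ?_
    congr 1
    generalize η⁻¹ ((1 : E ≃ₐ[K] E) : Cosets K L E) = t
    induction t using QuotientGroup.induction_on with
    | H g => rw [cosetEval_mk, algebraMap_smul, map_act]; rfl
  smul_zero h := by
    apply (algebraMap L E).injective
    rw [algebraMap_smul, act, actAt_mul_zero, map_zero]
  smul_add h x y := by
    apply (algebraMap L E).injective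
    rw [map_add, algebraMap_smul, algebraMap_smul, algebraMap_smul, act, actAt_mul_add]
    rfl
  add_smul h h' x := by
    apply (algebraMap L E).injective
    rw [map_add, algebraMap_smul, algebraMap_smul, algebraMap_smul, act, AddMemClass.coe_add,
      actAt_add]
    rfl
  zero_smul x := by
    apply (algebraMap L E).injective
    rw [algebraMap_smul, act, ZeroMemClass.coe_zero, actAt_zero, map_zero]

/-- `K` (hence every subring of `K`) acts on `L` through its embedding in `H` as usual. -/
lemma algebraMap_smul_eq [IsGalois K E] {N : Subgroup (Equiv.Perm (Cosets K L E))}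
    (c : K) (x : L) : (algebraMap K (hopfAlg K L E N) c) • x = c • x := by
  apply (algebraMap L E).injective
  rw [algebraMap_smul, act, Subalgebra.coe_algebraMap, MonoidAlgebra.coe_algebraMap,
    Function.comp_apply, actAt_single, Algebra.smul_def, map_mul,
    ← IsScalarTower.algebraMap_apply K L E]
  simp [cosetEval_mk]

/-! ### The associated order -/

section AssociatedOrder

variable (R : Type*) [CommRing R] [Algebra R K] [Algebra R L] [IsScalarTower R K L] [Algebra R E]
  [IsScalarTower R K E] [IsGalois K E]

/-- The associated order `𝔄_H = {h ∈ H | h · x ∈ O_L for all x ∈ O_L}`, where `O_L` is the integral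
closure of `R = O_K` in `L`. -/
def assocOrder (N : Subgroup (Equiv.Perm (Cosets K L E))) : Subalgebra R (hopfAlg K L E N) where
  carrier := {h | ∀ x ∈ integralClosure R L, h • x ∈ integralClosure R L}
  mul_mem' {a b} ha hb x hx := by rw [mul_smul]; exact ha _ (hb _ hx)
  add_mem' {a b} ha hb x hx := by rw [add_smul]; exact add_mem (ha _ hx) (hb _ hx)
  algebraMap_mem' r x hx := by
    have h1 : (algebraMap R (hopfAlg K L E N) r) • x = r • x := by
      rw [IsScalarTower.algebraMap_apply R K (hopfAlg K L E N), algebraMap_smul_eq,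
        _root_.algebraMap_smul]
    rw [h1]
    exact Subalgebra.smul_mem _ hx r

/-- `O_L` is a module over the associated order. -/
instance instModuleAssocOrder (N : Subgroup (Equiv.Perm (Cosets K L E))) :
    Module (assocOrder R N) (integralClosure R L) where
  smul h x := ⟨(h : hopfAlg K L E N) • (x : L), h.2 x x.2⟩
  one_smul x := Subtype.ext (one_smul (hopfAlg K L E N) (x : L))
  mul_smul a b x := Subtype.ext (mul_smul (a : hopfAlg K L E N) (b : hopfAlg K L E N) (x : L))
  smul_zero a := Subtype.ext (smul_zero (a : hopfAlg K L E N))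
  smul_add a x y := Subtype.ext (smul_add (a : hopfAlg K L E N) (x : L) (y : L))
  add_smul a b x := Subtype.ext (add_smul (a : hopfAlg K L E N) (b : hopfAlg K L E N) (x : L))
  zero_smul x := Subtype.ext (zero_smul (hopfAlg K L E N) (x : L))

end AssociatedOrder

end GreitherPareigis

/-! ### Almost classically Galois extensions

From now on all extensions of `K` are intermediate fields of a Galois extension `Ω / K` (for
instance a separable closure of `K`). -/

section AlmostClassical

variable {K Ω : Type*} [Field K] [Field Ω] [Algebra K Ω]

/-- `M` is a Galois complement of `L / K`: `M / K` is Galois and the multiplication map from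
`L ⊗ M` to `Ω` is injective with image the normal closure of `L / K`. Thus `L / K` is almost
classically Galois if and only if it has a Galois complement. -/
structure IsGaloisComplement (L M : IntermediateField K Ω) : Prop where
  isGalois : IsGalois K M
  linearDisjoint : L.LinearDisjoint M
  sup_eq : L ⊔ M = IntermediateField.normalClosure K L Ω

/-- Strong disjointness of two almost classically Galois extensions `L₁`, `L₂` of `K` with Galois
complements `M₁`, `M₂`. -/
structure StronglyDisjoint (L₁ M₁ L₂ M₂ : IntermediateField K Ω) : Prop where
  linearDisjoint : L₁.LinearDisjoint L₂
  inf_left : L₁ ⊓ M₂ = ⊥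
  inf_right : L₂ ⊓ M₁ = ⊥

/-- For a Galois complement `M` of `L / K`, the corresponding normal complement `J`: the group of
the elements of the Galois group of the normal closure of `L / K` that fix `M`. -/
def normalCompl (L M : IntermediateField K Ω) :
    Subgroup ((IntermediateField.normalClosure K L Ω) ≃ₐ[K]
      (IntermediateField.normalClosure K L Ω)) :=
  (M.comap (IntermediateField.normalClosure K L Ω).val).fixingSubgroup

/-- The subgroup `N` of `Perm(X)` that gives the almost classically Galois structure on `L / K`
corresponding to `M`: the opposite group, that is the centralizer in `Perm(X)`, of the group of the
left translations by the elements of `J`. -/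
def acSubgroup (L M : IntermediateField K Ω) :
    Subgroup (Equiv.Perm (Cosets K L (IntermediateField.normalClosure K L Ω))) :=
  Subgroup.centralizer
    ((normalCompl L M).map (leftTrans K L (IntermediateField.normalClosure K L Ω)) : Set _)

/-- The almost classically Galois structure `H` on `L / K` corresponding to the Galois complement
`M` (with its action on `L` from above). -/
abbrev acHopf (L M : IntermediateField K Ω) :=
  hopfAlg K L (IntermediateField.normalClosure K L Ω) (acSubgroup L M)

/-- The associated order of the integral closure of `R` in `L` in the almost classically Galois
structure on `L / K` corresponding to the Galois complement `M`. -/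
abbrev acOrder (R : Type*) [CommRing R] [Algebra R K] [Algebra R Ω] [IsScalarTower R K Ω]
    [IsGalois K Ω] (L M : IntermediateField K Ω) : Subalgebra R (acHopf L M) :=
  assocOrder (L := L) (E := IntermediateField.normalClosure K L Ω) R (acSubgroup L M)

variable (K Ω) in
/-- The field `K(ζ_m)`. -/
def cyclo (m : ℕ) : IntermediateField K Ω :=
  IntermediateField.adjoin K {ζ : Ω | IsPrimitiveRoot ζ m}

end AlmostClassical

end HopfGalois

end

open scoped TensorProduct

set_option linter.unusedSectionVars false

noncomputable section

namespace HopfGalois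

open Module

section Diagonal

variable {K L E : Type*} [Field K] [Field L] [Field E] [Algebra K L] [Algebra K E] [Algebra L E]
  [IsScalarTower K L E] {I : Type*}

/-- The elements of `J` act on the basis `b` of `L / K` through pairwise distinct characters `χ`,
and restriction to `L` is a bijection from `J` to the set of the restrictions of the elements
of `Gal(E/K)`. -/
structure DiagonalData (b : Basis I K L) (J : Subgroup (E ≃ₐ[K] E)) where
  /-- the characters -/
  χ : I → J →* E
  χ_injective : Function.Injective χ
  apply_basis : ∀ e (σ : J), (σ : E ≃ₐ[K] E) (algebraMap L E (b e)) =
    χ e σ * algebraMap L E (b e)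
  comm : ∀ σ ∈ J, ∀ τ ∈ J, σ * τ = τ * σ
  exists_eq : ∀ g : E ≃ₐ[K] E, ∃ σ ∈ J, ∀ x : L, g (algebraMap L E x) = σ (algebraMap L E x)
  eq_one : ∀ σ ∈ J, (∀ x : L, σ (algebraMap L E x) = algebraMap L E x) → σ = 1
  normal : J.Normal
  card_ne_zero : (Nat.card J : K) ≠ 0

lemma coset_eq_iff (g g' : E ≃ₐ[K] E) :
    (g : Cosets K L E) = g' ↔ ∀ x : L, g (algebraMap L E x) = g' (algebraMap L E x) := by
  rw [QuotientGroup.eq]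
  change g⁻¹ * g' ∈ (IsScalarTower.toAlgHom K L E).fieldRange.fixingSubgroup ↔ _
  rw [IntermediateField.mem_fixingSubgroup_iff]
  constructor
  · intro h x
    have h1 := congrArg g (h _ ⟨x, rfl⟩)
    rw [← AlgEquiv.mul_apply, mul_inv_cancel_left] at h1
    exact h1.symm
  · rintro h _ ⟨x, rfl⟩
    change g⁻¹ (g' (algebraMap L E x)) = _
    rw [← h x, ← AlgEquiv.mul_apply, inv_mul_cancel]
    rfl

lemma leftTrans_mk (g g' : E ≃ₐ[K] E) :
    leftTrans K L E g (g' : Cosets K L E) = ((g * g' : E ≃ₐ[K] E) : Cosets K L E) := rfl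

/-- The algebra `E[N]^G` for the centralizer `N` of `λ(J)`. -/
abbrev diagAlg (J : Subgroup (E ≃ₐ[K] E)) :=
  hopfAlg K L E (Subgroup.centralizer
    (J.map (leftTrans K L E) : Set (Equiv.Perm (Cosets K L E))))

lemma actAt_sum {S : Type*} (s : Finset S)
    (f : S → MonoidAlgebra E (Equiv.Perm (Cosets K L E))) (t : Cosets K L E) (x : L) :
    actAt K L E (∑ i ∈ s, f i) t x = ∑ i ∈ s, actAt K L E (f i) t x :=
  map_sum (AddMonoidHom.mk' (fun h => actAt K L E h t x) fun h h' => actAt_add h h' t x) f s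

namespace DiagonalData

variable {b : Basis I K L} {J : Subgroup (E ≃ₐ[K] E)} (D : DiagonalData b J)
include D

lemma finite : Finite J :=
  Nat.finite_of_card_ne_zero fun h => D.card_ne_zero (by rw [h, Nat.cast_zero])

lemma leftTrans_injective : Function.Injective fun σ : J => leftTrans K L E (σ : E ≃ₐ[K] E) := by
  intro σ τ h
  have h1 := congrArg (fun p => p ((1 : E ≃ₐ[K] E) : Cosets K L E)) h
  simp only [leftTrans_mk, mul_one] at h1
  rw [coset_eq_iff] at h1
  have h2 := D.eq_one (τ⁻¹ * σ : J) (τ⁻¹ * σ : J).2 (fun x => by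
    change (τ : E ≃ₐ[K] E)⁻¹ ((σ : E ≃ₐ[K] E) _) = _
    rw [h1, ← AlgEquiv.mul_apply, inv_mul_cancel]; rfl)
  have h3 : τ⁻¹ * σ = 1 := Subtype.ext h2
  exact (inv_mul_eq_one.mp h3).symm

lemma mem_centralizer_iff (η : Equiv.Perm (Cosets K L E)) :
    η ∈ Subgroup.centralizer (J.map (leftTrans K L E) : Set (Equiv.Perm (Cosets K L E))) ↔
      ∃ σ : J, leftTrans K L E (σ : E ≃ₐ[K] E) = η := by
  rw [Subgroup.mem_centralizer_iff]
  constructor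
  · intro h
    obtain ⟨g, hg⟩ := QuotientGroup.mk_surjective (η ((1 : E ≃ₐ[K] E) : Cosets K L E))
    obtain ⟨σ, hσ, hgσ⟩ := D.exists_eq g
    refine ⟨⟨σ, hσ⟩, ?_⟩
    ext t
    obtain ⟨g', rfl⟩ := QuotientGroup.mk_surjective t
    obtain ⟨τ, hτ, hgτ⟩ := D.exists_eq g'
    have h1 : (g' : Cosets K L E) = τ := (coset_eq_iff _ _).2 hgτ
    have h2 := congrArg (fun p => p ((1 : E ≃ₐ[K] E) : Cosets K L E))
      (h (leftTrans K L E τ) ⟨τ, hτ, rfl⟩)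
    simp only [Equiv.Perm.mul_apply, leftTrans_mk, mul_one] at h2
    rw [← hg, (coset_eq_iff g σ).2 hgσ, leftTrans_mk] at h2
    change leftTrans K L E σ (g' : Cosets K L E) = η (g' : Cosets K L E)
    rw [h1, ← h2, leftTrans_mk, D.comm σ hσ τ hτ]
  · rintro ⟨σ, rfl⟩ _ ⟨τ, hτ, rfl⟩
    rw [← map_mul, ← map_mul, D.comm _ hτ _ σ.2]

lemma support_subset [Fintype J] [DecidableEq (Equiv.Perm (Cosets K L E))]
    (h : diagAlg (L := L) J) : (h : MonoidAlgebra E _).coeff.support ⊆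
      Finset.univ.image fun σ : J => leftTrans K L E (σ : E ≃ₐ[K] E) := by
  obtain ⟨h', hh'⟩ := h.2.1
  intro η hη
  rw [← hh'] at hη
  obtain ⟨ν, -, rfl⟩ := Finset.mem_image.mp (Finsupp.mapDomain_support hη)
  obtain ⟨σ, hσ⟩ := (D.mem_centralizer_iff _).mp ν.2
  exact Finset.mem_image.mpr ⟨σ, Finset.mem_univ _, hσ⟩

lemma actAt_eq [Fintype J]
    (h : diagAlg (L := L) J)
    (g : E ≃ₐ[K] E) (x : L) :
    actAt K L E h (g : Cosets K L E) x = ∑ σ : J, (h : MonoidAlgebra E _).coeff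
      (leftTrans K L E (σ : E ≃ₐ[K] E)) * (σ : E ≃ₐ[K] E)⁻¹ (g (algebraMap L E x)) := by
  classical
  unfold actAt
  rw [Finsupp.sum_of_support_subset _ (D.support_subset h) _ (by simp),
    Finset.sum_image fun σ _ τ _ hστ => D.leftTrans_injective hστ]
  refine Finset.sum_congr rfl fun σ _ => ?_
  rw [← map_inv, leftTrans_mk, cosetEval_mk]
  rfl

lemma χ_inv_mul (e : I) (σ : J) : D.χ e σ⁻¹ * D.χ e σ = 1 := by
  rw [← map_mul, inv_mul_cancel, map_one]

lemma χ_ne_zero (e : I) (σ : J) : D.χ e σ ≠ 0 := right_ne_zero_of_mul_eq_one (D.χ_inv_mul e σ)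

omit D in
lemma algebraMap_basis_ne_zero (b : Basis I K L) (e : I) : algebraMap L E (b e) ≠ 0 := by
  rw [Ne, map_eq_zero]
  exact b.ne_zero e

lemma apply_χ (e : I) (σ τ : J) : (σ : E ≃ₐ[K] E) (D.χ e τ) = D.χ e τ := by
  have h := D.apply_basis e (σ * τ)
  rw [map_mul] at h
  change (σ : E ≃ₐ[K] E) ((τ : E ≃ₐ[K] E) _) = _ at h
  rw [D.apply_basis, map_mul, D.apply_basis] at h
  have h1 := algebraMap_basis_ne_zero (E := E) b e
  have h2 := D.χ_ne_zero e σ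
  refine mul_right_cancel₀ (mul_ne_zero h2 h1) ?_
  rw [h]; ring

variable [IsGalois K E]

lemma exists_eigenvalue (h : diagAlg (L := L) J) (e : I) :
    ∃ c : K, h • b e = c • b e := by
  have := D.finite
  have := Fintype.ofFinite J
  set c' : E := ∑ σ : J, (h : MonoidAlgebra E _).coeff
      (leftTrans K L E (σ : E ≃ₐ[K] E)) * D.χ e σ⁻¹ with hc'
  have h0 := algebraMap_basis_ne_zero (E := E) b e
  have h1 (τ : J) : actAt K L E h ((τ : E ≃ₐ[K] E) : Cosets K L E) (b e) =
      D.χ e τ * c' * algebraMap L E (b e) := by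
    rw [D.actAt_eq, hc', Finset.mul_sum, Finset.sum_mul]
    refine Finset.sum_congr rfl fun σ _ => ?_
    rw [D.apply_basis, map_mul]
    have h2 := D.apply_χ e σ⁻¹ τ
    have h3 := D.apply_basis e σ⁻¹
    rw [InvMemClass.coe_inv] at h2 h3
    rw [h2, h3]
    ring
  have h2 : act K L E h (b e) = c' * algebraMap L E (b e) := by
    have := h1 1
    rw [map_one, one_mul] at this
    exact this
  have h3 : ∀ g : E ≃ₐ[K] E, g c' = c' := by
    intro g
    have h4 := map_act h g (b e)
    obtain ⟨σ, hσ, hg⟩ := D.exists_eq g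
    rw [(coset_eq_iff g σ).2 hg, h1 ⟨σ, hσ⟩, h2, map_mul, hg, D.apply_basis e ⟨σ, hσ⟩] at h4
    have h5 := D.χ_ne_zero e ⟨σ, hσ⟩
    refine mul_right_cancel₀ (mul_ne_zero h5 h0) ?_
    rw [h4]; ring
  obtain ⟨c, hc⟩ := (InfiniteGalois.mem_range_algebraMap_iff_fixed c').2 h3
  refine ⟨c, (algebraMap L E).injective ?_⟩
  rw [algebraMap_smul, h2, ← hc, Algebra.smul_def, map_mul,
    ← IsScalarTower.algebraMap_apply K L E]

omit D in
lemma smul_comm_of_field {N : Subgroup (Equiv.Perm (Cosets K L E))}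
    (h : hopfAlg K L E N) (c : K) (x : L) : h • (c • x) = c • (h • x) := by
  rw [← algebraMap_smul_eq (N := N) (E := E), ← mul_smul, ← Algebra.commutes, mul_smul,
    algebraMap_smul_eq]

/-- The eigenvalue of `h` on a basis vector. -/
def eigenvalue (h : diagAlg (L := L) J) (e : I) : K := (D.exists_eigenvalue h e).choose

lemma smul_basis (h : diagAlg (L := L) J) (e : I) : h • b e = D.eigenvalue h e • b e :=
  (D.exists_eigenvalue h e).choose_spec

lemma eigenvalue_eq {h : diagAlg (L := L) J} {e : I} {c : K} (hc : h • b e = c • b e) :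
    D.eigenvalue h e = c :=
  smul_left_injective K (b.ne_zero e) ((D.smul_basis h e).symm.trans hc)

/-- The eigenvalues of the elements of the Hopf algebra on a basis. -/
def eigenvalues : diagAlg (L := L) J →ₐ[K] (I → K) where
  toFun := D.eigenvalue
  map_one' := funext fun e => D.eigenvalue_eq ((one_smul _ _).trans (one_smul _ _).symm)
  map_zero' := funext fun e => D.eigenvalue_eq ((zero_smul _ _).trans (zero_smul _ _).symm)
  map_mul' h h' := funext fun e => D.eigenvalue_eq (by
    rw [mul_smul, D.smul_basis h' e, smul_comm_of_field, D.smul_basis h e, smul_smul, mul_comm,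
      Pi.mul_apply])
  map_add' h h' := funext fun e => D.eigenvalue_eq (by
    rw [add_smul, D.smul_basis h' e, D.smul_basis h e, ← add_smul, Pi.add_apply])
  commutes' c := funext fun e => D.eigenvalue_eq (algebraMap_smul_eq c (b e))

lemma repr_smul [Finite I] (h : diagAlg (L := L) J) (x : L) (e : I) :
    b.repr (h • x) e = D.eigenvalues h e * b.repr x e := by
  classical
  have := Fintype.ofFinite I
  conv_lhs => rw [← b.sum_repr x]
  rw [Finset.smul_sum, map_sum, Finset.sum_apply']
  have h1 (i : I) : b.repr (h • b.repr x i • b i) e =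
      if i = e then D.eigenvalues h e * b.repr x e else 0 := by
    rw [smul_comm_of_field, D.smul_basis, map_smul, map_smul, b.repr_self, Finsupp.smul_apply,
      Finsupp.smul_apply, Finsupp.single_apply]
    split_ifs with hi
    · subst hi
      simp only [smul_eq_mul, mul_one]
      exact mul_comm _ _
    · simp
  simp only [h1, Finset.sum_ite_eq', Finset.mem_univ, if_true]

lemma eigenvalues_injective [Finite I] : Function.Injective D.eigenvalues := by
  classical
  have := D.finite
  have := Fintype.ofFinite J
  rw [injective_iff_map_eq_zero]
  intro h hh
  have h1 (x : L) : h • x = 0 := b.repr.injective <| Finsupp.ext fun e => by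
    rw [D.repr_smul, hh, map_zero, Pi.zero_apply, zero_mul, Finsupp.zero_apply]
  let f : J → L →* E := fun σ =>
    (((σ⁻¹ : J) : E ≃ₐ[K] E) : E →* E).comp (algebraMap L E : L →* E)
  have hf : Function.Injective f := by
    intro σ τ hστ
    have h2 := D.eq_one (τ * σ⁻¹ : J) (τ * σ⁻¹ : J).2 (fun x => by
      have h3 : ((σ⁻¹ : J) : E ≃ₐ[K] E) (algebraMap L E x) =
        ((τ⁻¹ : J) : E ≃ₐ[K] E) (algebraMap L E x) := DFunLike.congr_fun hστ x
      change (τ : E ≃ₐ[K] E) (((σ⁻¹ : J) : E ≃ₐ[K] E) _) = _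
      rw [h3, InvMemClass.coe_inv, ← AlgEquiv.mul_apply, mul_inv_cancel]; rfl)
    have h3 : τ * σ⁻¹ = 1 := Subtype.ext h2
    exact (mul_inv_eq_one.mp h3).symm
  have h2 := (linearIndependent_monoidHom L E).comp f hf
  rw [Fintype.linearIndependent_iff] at h2
  have h3 := h2 (fun σ => (h : MonoidAlgebra E _).coeff (leftTrans K L E (σ : E ≃ₐ[K] E)))
    (funext fun x => by
      have h4 := algebraMap_smul h x
      rw [h1, map_zero, act, D.actAt_eq] at h4
      rw [Finset.sum_apply]
      exact h4.symm)
  have h4 : (h : MonoidAlgebra E (Equiv.Perm (Cosets K L E))).coeff.support = ∅ := by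
    rw [Finset.eq_empty_iff_forall_notMem]
    intro η hη
    obtain ⟨σ, -, rfl⟩ := Finset.mem_image.mp (D.support_subset h hη)
    exact Finsupp.mem_support_iff.mp hη (h3 σ)
  apply Subtype.ext
  apply MonoidAlgebra.coeff_injective
  exact Finsupp.support_eq_empty.mp h4

omit [IsGalois K E] in
lemma χ_conj (g : E ≃ₐ[K] E) (e : I) (σ τ : J) (h : (τ : E ≃ₐ[K] E) = g * σ * g⁻¹) :
    D.χ e τ = g (D.χ e σ) := by
  obtain ⟨ρ, hρ, hg⟩ := D.exists_eq g
  have h1 := congrArg (fun u : E ≃ₐ[K] E => (u * g) (algebraMap L E (b e))) h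
  simp only [inv_mul_cancel_right, AlgEquiv.mul_apply, D.apply_basis, map_mul, hg] at h1
  rw [D.apply_basis e ⟨ρ, hρ⟩, map_mul, D.apply_χ, D.apply_basis] at h1
  have h2 := D.χ_ne_zero e ⟨ρ, hρ⟩
  have h3 := algebraMap_basis_ne_zero (E := E) b e
  refine mul_right_cancel₀ (mul_ne_zero h2 h3) ?_
  rw [← h1]; ring

omit [IsGalois K E] in
lemma sum_χ [Fintype J] [DecidableEq I] (e e' : I) :
    ∑ σ : J, D.χ e' σ * D.χ e σ⁻¹ = if e' = e then (Nat.card J : E) else 0 := by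
  split_ifs with h
  · subst h
    rw [Finset.sum_congr rfl fun σ _ => (mul_comm _ _).trans (D.χ_inv_mul e' σ)]
    simp [Nat.card_eq_fintype_card]
  · let f : J →* E :=
      { toFun := fun σ => D.χ e' σ * D.χ e σ⁻¹
        map_one' := by simp
        map_mul' := fun σ τ => by rw [mul_inv_rev, map_mul, map_mul]; ring }
    refine sum_hom_units_eq_zero f fun hf => h (D.χ_injective (MonoidHom.ext fun σ => ?_))
    have h1 : D.χ e' σ * D.χ e σ⁻¹ = 1 := DFunLike.congr_fun hf σ
    have h2 := D.χ_inv_mul e σ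
    have h3 := D.χ_ne_zero e σ⁻¹
    refine mul_right_cancel₀ h3 ?_
    rw [h1, mul_comm, h2]

lemma eigenvalues_surjective [Finite I] : Function.Surjective D.eigenvalues := by
  classical
  intro c
  have := D.finite
  have := Fintype.ofFinite J
  have := Fintype.ofFinite I
  have := D.normal
  let u (σ : J) : E := (Nat.card J : E)⁻¹ * ∑ e, algebraMap K E (c e) * D.χ e σ
  have hu (g : E ≃ₐ[K] E) (σ : J) : g (u σ) = u (MulAut.conjNormal g σ) := by
    simp only [u, map_mul, map_inv₀, map_natCast, map_sum, AlgEquiv.commutes]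
    congr 1
    refine Finset.sum_congr rfl fun e _ => ?_
    rw [D.χ_conj g e σ _ (MulAut.conjNormal_apply g σ)]
  let h₀ : MonoidAlgebra E (Equiv.Perm (Cosets K L E)) :=
    ∑ σ : J, MonoidAlgebra.single (leftTrans K L E (σ : E ≃ₐ[K] E)) (u σ)
  have h₀mem : h₀ ∈ diagAlg (L := L) J := by
    refine ⟨sum_mem fun σ _ => ⟨MonoidAlgebra.single
      ⟨leftTrans K L E (σ : E ≃ₐ[K] E), (D.mem_centralizer_iff _).2 ⟨σ, rfl⟩⟩ (u σ),
      MonoidAlgebra.mapDomain_single⟩,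
      Algebra.mem_iInf.mpr fun g => ?_⟩
    change twist K L E g h₀ = h₀
    simp only [h₀, map_sum, twist_single, hu]
    refine Fintype.sum_equiv (MulAut.conjNormal g).toEquiv _ _ fun σ => ?_
    rw [← map_inv, ← map_mul, ← map_mul]
    congr 2
  refine ⟨⟨h₀, h₀mem⟩, funext fun e => D.eigenvalue_eq ((algebraMap L E).injective ?_)⟩
  have hJ : (Nat.card J : E) ≠ 0 := by
    rw [← map_natCast (algebraMap K E), Ne, map_eq_zero]
    exact D.card_ne_zero
  have h1 (σ : J) : actAt K L E (MonoidAlgebra.single (leftTrans K L E (σ : E ≃ₐ[K] E)) (u σ))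
      ((1 : E ≃ₐ[K] E) : Cosets K L E) (b e) =
      (u σ * D.χ e σ⁻¹) * algebraMap L E (b e) := by
    have h2 := D.apply_basis e σ⁻¹
    rw [InvMemClass.coe_inv] at h2
    rw [actAt_single, ← map_inv, leftTrans_mk, mul_one, cosetEval_mk, h2]
    exact (mul_assoc _ _ _).symm
  rw [algebraMap_smul, act, actAt_sum, Finset.sum_congr rfl fun σ _ => h1 σ, ← Finset.sum_mul,
    Algebra.smul_def, map_mul, ← IsScalarTower.algebraMap_apply K L E]
  congr 1
  simp only [u, mul_assoc, ← Finset.mul_sum, Finset.sum_mul]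
  rw [Finset.sum_comm]
  simp only [← Finset.mul_sum, D.sum_χ, mul_ite, mul_zero, Finset.sum_ite_eq', Finset.mem_univ,
    if_true]
  rw [mul_left_comm, inv_mul_cancel₀ hJ, mul_one]

/-- The Hopf algebra is the algebra of the endomorphisms that are diagonal in the basis. -/
def eigenEquiv [Finite I] : diagAlg (L := L) J ≃ₐ[K] (I → K) :=
  AlgEquiv.ofBijective D.eigenvalues ⟨D.eigenvalues_injective, D.eigenvalues_surjective⟩

section Order

variable {R : Type*} [CommRing R] [Algebra R K] [Algebra R L] [IsScalarTower R K L] [Algebra R E]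
  [IsScalarTower R K E] [Finite I]
  (hb : ∀ x : L, x ∈ integralClosure R L ↔ ∀ e, b.repr x e ∈ (algebraMap R K).range)
include hb

lemma mem_assocOrder_iff (h : diagAlg (L := L) J) :
    h ∈ assocOrder R (Subgroup.centralizer
      (J.map (leftTrans K L E) : Set (Equiv.Perm (Cosets K L E)))) ↔
      ∀ e, D.eigenvalues h e ∈ (algebraMap R K).range := by
  classical
  constructor
  · intro hh e
    have h1 : b e ∈ integralClosure R L := (hb _).2 fun e' => by
      rw [b.repr_self, Finsupp.single_apply]
      split_ifs
      · exact one_mem _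
      · exact zero_mem _
    have h2 := (hb _).1 (hh _ h1) e
    rwa [D.repr_smul, b.repr_self, Finsupp.single_eq_same, mul_one] at h2
  · intro hh x hx
    refine (hb _).2 fun e => ?_
    rw [D.repr_smul]
    exact mul_mem (hh e) ((hb _).1 hx e)

/-- The element of the associated order with given eigenvalues. -/
def orderHom : (I → R) →ₐ[R] assocOrder R (Subgroup.centralizer
      (J.map (leftTrans K L E) : Set (Equiv.Perm (Cosets K L E)))) :=
  (((D.eigenEquiv.symm : (I → K) →ₐ[K] diagAlg (L := L) J).restrictScalars R).comp
    ((Algebra.ofId R K).compLeft I)).codRestrict (assocOrder R (Subgroup.centralizer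
      (J.map (leftTrans K L E) : Set (Equiv.Perm (Cosets K L E))))) fun r =>
    (D.mem_assocOrder_iff hb _).2 fun e =>
      ⟨r e, (congrFun (D.eigenEquiv.apply_symm_apply (algebraMap R K ∘ r)) e).symm⟩

lemma eigenEquiv_orderHom (r : I → R) (e : I) :
    D.eigenEquiv (D.orderHom hb r : diagAlg (L := L) J) e = algebraMap R K (r e) :=
  congrFun (D.eigenEquiv.apply_symm_apply (algebraMap R K ∘ r)) e

/-- The associated order consists of the endomorphisms that are diagonal in the basis with
entries in `R`. -/
def orderEquiv [FaithfulSMul R K] : assocOrder R (Subgroup.centralizer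
      (J.map (leftTrans K L E) : Set (Equiv.Perm (Cosets K L E)))) ≃ₐ[R] (I → R) :=
  (AlgEquiv.ofBijective (D.orderHom hb) ⟨fun r r' h => funext fun e =>
    FaithfulSMul.algebraMap_injective R K (by
      rw [← D.eigenEquiv_orderHom hb, ← D.eigenEquiv_orderHom hb, h]), fun h => by
      choose r hr using (D.mem_assocOrder_iff hb _).1 h.2
      exact ⟨r, Subtype.ext (D.eigenEquiv.injective (funext fun e =>
        (D.eigenEquiv_orderHom hb r e).trans (hr e)))⟩⟩).symm

lemma algebraMap_orderEquiv [FaithfulSMul R K] (h : assocOrder R (Subgroup.centralizer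
      (J.map (leftTrans K L E) : Set (Equiv.Perm (Cosets K L E))))) (e : I) :
    algebraMap R K (D.orderEquiv hb h e) = D.eigenEquiv (h : diagAlg (L := L) J) e := by
  obtain ⟨r, rfl⟩ := (D.orderEquiv hb).symm.surjective h
  rw [AlgEquiv.apply_symm_apply]
  exact (D.eigenEquiv_orderHom hb r e).symm

lemma free_assocOrder : Module.Free (assocOrder R (Subgroup.centralizer
      (J.map (leftTrans K L E) : Set (Equiv.Perm (Cosets K L E))))) (integralClosure R L) := by
  have := Fintype.ofFinite I
  have h0 (e : I) : b.repr (∑ i, b i) e = 1 := by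
    classical
    simp [map_sum, Finsupp.single_apply]
  let v : integralClosure R L := ⟨∑ e, b e, (hb _).2 fun e => by rw [h0]; exact one_mem _⟩
  have hv (h : assocOrder R (Subgroup.centralizer
      (J.map (leftTrans K L E) : Set (Equiv.Perm (Cosets K L E))))) (e : I) :
      b.repr ((h • v : integralClosure R L) : L) e = D.eigenvalues (h : diagAlg (L := L) J) e := by
    refine (D.repr_smul (h : diagAlg (L := L) J) (∑ e, b e) e).trans ?_
    rw [h0, mul_one]
  refine Module.Free.of_equiv (LinearEquiv.ofBijective
    (LinearMap.toSpanSingleton (assocOrder R (Subgroup.centralizer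
      (J.map (leftTrans K L E) : Set (Equiv.Perm (Cosets K L E))))) (integralClosure R L) v)
    ⟨fun h h' hh => ?_, fun x => ?_⟩)
  · refine Subtype.ext (D.eigenvalues_injective (funext fun e => ?_))
    rw [← hv, ← hv]
    exact congrArg (fun y : integralClosure R L => b.repr (y : L) e) hh
  · obtain ⟨h, hh⟩ := D.eigenvalues_surjective fun e => b.repr (x : L) e
    refine ⟨⟨h, (D.mem_assocOrder_iff hb h).2 fun e => ?_⟩, Subtype.ext (b.repr.injective
      (Finsupp.ext fun e => ?_))⟩
    · rw [hh]
      exact (hb _).1 x.2 e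
    · exact (hv _ e).trans (congrFun hh e)

end Order

end DiagonalData

end Diagonal

section Roots

variable {K Ω : Type*} [Field K] [Field Ω] [Algebra K Ω]

lemma minpoly_eq_of_irreducible {n : ℕ} {c : K} {α : Ω} (hn : n ≠ 0)
    (hα : α ^ n = algebraMap K Ω c)
    (hirr : Irreducible (Polynomial.X ^ n - Polynomial.C c : Polynomial K)) :
    minpoly K α = Polynomial.X ^ n - Polynomial.C c :=
  (minpoly.eq_of_irreducible_of_monic hirr (by simp [hα])
    (Polynomial.monic_X_pow_sub_C c hn)).symm

lemma exists_algEquiv_apply_eq_mul [Normal K Ω] {n : ℕ} {c : K} {α : Ω} (hn : n ≠ 0)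
    (hα : α ^ n = algebraMap K Ω c)
    (hirr : Irreducible (Polynomial.X ^ n - Polynomial.C c : Polynomial K)) {ζ : Ω}
    (hζ : ζ ^ n = 1) : ∃ g : Ω ≃ₐ[K] Ω, g α = ζ * α := by
  refine minpoly.exists_algEquiv_of_root' (Algebra.IsAlgebraic.isAlgebraic α) ?_
  rw [minpoly_eq_of_irreducible hn hα hirr]
  simp [mul_pow, hζ, hα]

lemma exists_isPrimitiveRoot_of_irreducible [Normal K Ω] {n : ℕ} {c : K} {α : Ω}
    (hn : (n : K) ≠ 0) (hc : c ≠ 0) (hα : α ^ n = algebraMap K Ω c)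
    (hirr : Irreducible (Polynomial.X ^ n - Polynomial.C c : Polynomial K)) :
    ∃ ζ : Ω, IsPrimitiveRoot ζ n := by
  classical
  have hn0 : n ≠ 0 := by rintro rfl; simp at hn
  have : NeZero n := ⟨hn0⟩
  have hα0 : α ≠ 0 := by
    rintro rfl
    rw [zero_pow hn0] at hα
    exact hc ((map_eq_zero (algebraMap K Ω)).1 hα.symm)
  have h1 := Polynomial.card_rootSet_eq_natDegree (K := Ω)
    (Polynomial.separable_X_pow_sub_C c hn hc) (by
      rw [← minpoly_eq_of_irreducible hn0 hα hirr]
      exact Normal.splits inferInstance α)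
  rw [Polynomial.natDegree_X_pow_sub_C] at h1
  have h2 (x : (Polynomial.X ^ n - Polynomial.C c : Polynomial K).rootSet Ω) :
      (x / α : Ω) ^ n = 1 := by
    have := (Polynomial.mem_rootSet.1 x.2).2
    rw [map_sub, map_pow, Polynomial.aeval_X, Polynomial.aeval_C, sub_eq_zero] at this
    rw [div_pow, this, hα, div_self]
    rwa [Ne, map_eq_zero]
  let f : (Polynomial.X ^ n - Polynomial.C c : Polynomial K).rootSet Ω → rootsOfUnity n Ω :=
    fun x => rootsOfUnity.mkOfPowEq _ (h2 x)
  have hf : Function.Injective f := fun x y hxy => by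
    have h3 := congrArg (fun u : rootsOfUnity n Ω => ((u : Ωˣ) : Ω)) hxy
    simp only [f, rootsOfUnity.coe_mkOfPowEq] at h3
    exact Subtype.ext ((div_left_inj' hα0).1 h3)
  have h3 := Nat.card_le_card_of_injective f hf
  rw [Nat.card_eq_fintype_card, h1] at h3
  exact (HasEnoughRootsOfUnity.of_card_le h3).prim

lemma exists_isPrimitiveRoot_lcm {ι : Type*} (s : Finset ι) (n : ι → ℕ) (hn : ∀ i, n i ≠ 0)
    (F : IntermediateField K Ω) (h : ∀ i, ∃ ζ ∈ F, IsPrimitiveRoot ζ (n i)) :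
    ∃ ζ ∈ F, IsPrimitiveRoot ζ (s.lcm n) := by
  classical
  induction s using Finset.induction_on with
  | empty => exact ⟨1, one_mem _, by simp⟩
  | insert i s _ ih =>
    obtain ⟨ζ, hζ, h1⟩ := h i
    obtain ⟨ξ, hξ, h2⟩ := ih
    rw [Finset.lcm_insert]
    exact ⟨_, mul_mem (pow_mem hζ _) (pow_mem hξ _), h1.pow_mul_pow_lcm h2 (hn i)
      (Finset.lcm_ne_zero_iff.2 fun i _ => hn i)⟩

lemma mem_cyclo {m : ℕ} [NeZero m] {ζ x : Ω} (hζ : IsPrimitiveRoot ζ m) (hx : x ^ m = 1) :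
    x ∈ cyclo K Ω m := by
  obtain ⟨i, -, rfl⟩ := hζ.eq_pow_of_pow_eq_one hx
  exact _root_.pow_mem (S := cyclo K Ω m) (IntermediateField.subset_adjoin K _ hζ) i

instance normal_cyclo [Normal K Ω] (m : ℕ) : Normal K (cyclo K Ω m) := by
  rw [IntermediateField.normal_iff_forall_map_le']
  intro σ
  rw [cyclo, IntermediateField.adjoin_map]
  refine IntermediateField.adjoin.mono _ _ _ ?_
  rintro _ ⟨ζ, hζ, rfl⟩
  exact IsPrimitiveRoot.map_of_injective (f := (σ : Ω →ₐ[K] Ω)) hζ σ.injective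

instance isGalois_cyclo [IsGalois K Ω] (m : ℕ) : IsGalois K (cyclo K Ω m) where

lemma finiteDimensional_cyclo {m : ℕ} [NeZero m] {ζ : Ω} (hζ : IsPrimitiveRoot ζ m) :
    FiniteDimensional K (cyclo K Ω m) := by
  have h : cyclo K Ω m = IntermediateField.adjoin K {ζ} := by
    refine le_antisymm (IntermediateField.adjoin_le_iff.2 fun x hx => ?_)
      (IntermediateField.adjoin.mono _ _ _ (by simpa using hζ))
    obtain ⟨i, -, rfl⟩ := hζ.eq_pow_of_pow_eq_one hx.pow_eq_one
    exact pow_mem (IntermediateField.mem_adjoin_simple_self K ζ) i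
  rw [h]
  exact IntermediateField.adjoin.finiteDimensional
    (IsIntegral.of_pow (NeZero.pos m) (by rw [hζ.pow_eq_one]; exact isIntegral_one))

end Roots

section Monomials

variable {ι : Type*} [Fintype ι]

/-- The monomials of degree less than `n i` in the `i`-th variable span the algebra generated by
`n i`-th roots. -/
lemma adjoin_le_span_monomials {R B : Type*} [CommRing R] [CommRing B] [Algebra R B]
    {n : ι → ℕ} (hn : ∀ i, n i ≠ 0) {A : ι → B} {c : ι → R}
    (hA : ∀ i, A i ^ n i = algebraMap R B (c i)) :
    Subalgebra.toSubmodule (Algebra.adjoin R (Set.range A)) ≤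
      Submodule.span R (Set.range fun e : ∀ i, Fin (n i) => ∏ i, A i ^ (e i : ℕ)) := by
  classical
  rw [Algebra.adjoin_eq_span]
  refine Submodule.span_le.2 fun x hx => ?_
  have h1 : ∃ s : ι → ℕ, x = ∏ i, A i ^ s i := by
    induction hx using Submonoid.closure_induction with
    | mem x hx =>
      obtain ⟨i, rfl⟩ := hx
      refine ⟨Pi.single i 1, ?_⟩
      rw [Fintype.prod_eq_single i fun j hj => by rw [Pi.single_eq_of_ne hj, pow_zero],
        Pi.single_eq_same, pow_one]
    | one => exact ⟨0, by simp⟩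
    | mul x y _ _ hx hy =>
      obtain ⟨s, rfl⟩ := hx
      obtain ⟨t, rfl⟩ := hy
      exact ⟨s + t, by simp only [Pi.add_apply, pow_add, Finset.prod_mul_distrib]⟩
  obtain ⟨s, rfl⟩ := h1
  have h2 : ∏ i, A i ^ s i = (∏ i, c i ^ (s i / n i)) •
      ∏ i, A i ^ ((⟨s i % n i, Nat.mod_lt _ (Nat.pos_of_ne_zero (hn i))⟩ : Fin (n i)) : ℕ) := by
    rw [Algebra.smul_def, map_prod, ← Finset.prod_mul_distrib]
    refine Finset.prod_congr rfl fun i _ => ?_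
    rw [map_pow, ← hA, ← pow_mul, ← pow_add, Nat.div_add_mod]
  rw [h2]
  exact Submodule.smul_mem _ _ (Submodule.subset_span ⟨_, rfl⟩)

lemma span_monomials_eq_top {K Ω : Type*} [Field K] [Field Ω] [Algebra K Ω] {n : ι → ℕ}
    (hn : ∀ i, n i ≠ 0) {α : ι → Ω} {c : ι → K} (hα : ∀ i, α i ^ n i = algebraMap K Ω (c i))
    {L : IntermediateField K Ω} (hL : L = IntermediateField.adjoin K (Set.range α))
    (hmem : ∀ i, α i ∈ L) :
    Submodule.span K (Set.range fun e : ∀ i, Fin (n i) =>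
      ∏ i, (⟨α i, hmem i⟩ : L) ^ (e i : ℕ)) = ⊤ := by
  have h1 := adjoin_le_span_monomials (R := K) (B := L) hn (A := fun i => ⟨α i, hmem i⟩)
    (c := c) fun i => Subtype.ext (hα i)
  have h2 : Algebra.adjoin K (Set.range fun i => (⟨α i, hmem i⟩ : L)) = ⊤ := by
    have h3 := IntermediateField.adjoin_toSubalgebra_of_isAlgebraic (F := K) (S := Set.range α) (by
      rintro _ ⟨i, rfl⟩
      exact (IsIntegral.of_pow (Nat.pos_of_ne_zero (hn i))
        (by rw [hα]; exact isIntegral_algebraMap)).isAlgebraic)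
    rw [← hL] at h3
    refine eq_top_iff.2 fun x _ => ?_
    have h4 : (x : Ω) ∈ Algebra.adjoin K (Set.range α) := h3 ▸ x.2
    have h5 : Set.range α = L.val '' Set.range fun i => (⟨α i, hmem i⟩ : L) := by
      rw [← Set.range_comp]; rfl
    rw [h5, ← AlgHom.map_adjoin] at h4
    obtain ⟨y, hy, hxy⟩ := h4
    rwa [← show y = x from Subtype.ext hxy]
  rw [h2, Algebra.top_toSubmodule] at h1
  exact top_le_iff.1 h1

end Monomials

/-- `L = K(α_i : i)` for `n i`-th roots `α i` of degree `n i` such that `[L : K] = ∏ n i` and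
`L ∩ K(ζ_m) = K`, where `m` is the least common multiple of the `n i`. -/
structure KummerFamily {K Ω : Type*} [Field K] [Field Ω] [Algebra K Ω] {ι : Type*} [Fintype ι]
    (n : ι → ℕ) (α : ι → Ω) (m : ℕ) (L : IntermediateField K Ω) : Prop where
  eq_lcm : m = Finset.univ.lcm n
  ne_zero : (m : K) ≠ 0
  exists_pow : ∀ i, ∃ c : K, c ≠ 0 ∧ α i ^ n i = algebraMap K Ω c ∧
    Irreducible (Polynomial.X ^ n i - Polynomial.C c : Polynomial K)
  eq_adjoin : L = IntermediateField.adjoin K (Set.range α)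
  inf_eq : L ⊓ cyclo K Ω m = ⊥
  finrank_eq : finrank K L = ∏ i, n i

namespace KummerFamily

variable {K Ω : Type*} [Field K] [Field Ω] [Algebra K Ω] {ι : Type*} [Fintype ι]
  {n : ι → ℕ} {α : ι → Ω} {m : ℕ} {L : IntermediateField K Ω} (T : KummerFamily n α m L)
include T

lemma dvd (i : ι) : n i ∣ m := T.eq_lcm ▸ Finset.dvd_lcm (Finset.mem_univ i)

lemma pow_eq_one {M : Type*} [Monoid M] {x : M} {i : ι} (h : x ^ n i = 1) : x ^ m = 1 := by
  obtain ⟨d, hd⟩ := T.dvd i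
  rw [hd, pow_mul, h, one_pow]

lemma n_ne_zero (i : ι) : (n i : K) ≠ 0 := fun h => T.ne_zero (by
  obtain ⟨d, hd⟩ := T.dvd i
  rw [hd, Nat.cast_mul, h, zero_mul])

lemma pos (i : ι) : n i ≠ 0 := fun h => T.n_ne_zero i (by rw [h, Nat.cast_zero])

lemma neZero : NeZero m := ⟨fun h => T.ne_zero (by rw [h, Nat.cast_zero])⟩

lemma α_ne_zero (i : ι) : α i ≠ 0 := by
  obtain ⟨c, hc, h, -⟩ := T.exists_pow i
  rintro h0
  rw [h0, zero_pow (T.pos i)] at h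
  exact hc ((map_eq_zero (algebraMap K Ω)).1 h.symm)

lemma isIntegral (i : ι) : IsIntegral K (α i) := by
  obtain ⟨c, -, h, -⟩ := T.exists_pow i
  exact IsIntegral.of_pow (Nat.pos_of_ne_zero (T.pos i)) (by rw [h]; exact isIntegral_algebraMap)

lemma α_mem (i : ι) : α i ∈ L := by
  rw [T.eq_adjoin]
  exact IntermediateField.subset_adjoin _ _ ⟨i, rfl⟩

lemma finiteDimensional : FiniteDimensional K L := by
  rw [T.eq_adjoin]
  exact IntermediateField.finiteDimensional_adjoin (by rintro _ ⟨i, rfl⟩; exact T.isIntegral i)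

lemma exists_primitive [Normal K Ω] (i : ι) : ∃ ζ : Ω, IsPrimitiveRoot ζ (n i) := by
  obtain ⟨c, hc, h, hirr⟩ := T.exists_pow i
  exact exists_isPrimitiveRoot_of_irreducible (T.n_ne_zero i) hc h hirr

lemma exists_primitive' [Normal K Ω] : ∃ ζ : Ω, IsPrimitiveRoot ζ m := by
  obtain ⟨ζ, -, h⟩ := exists_isPrimitiveRoot_lcm (K := K) Finset.univ n T.pos ⊤ fun i => by
    obtain ⟨ζ, h⟩ := T.exists_primitive i
    exact ⟨ζ, trivial, h⟩
  exact ⟨ζ, T.eq_lcm ▸ h⟩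

lemma sup_cyclo [Normal K Ω] : L ⊔ cyclo K Ω m = IntermediateField.normalClosure K L Ω := by
  have := T.neZero
  obtain ⟨ζ, hζ⟩ := T.exists_primitive'
  refine le_antisymm (sup_le (IntermediateField.le_normalClosure _) ?_) ?_
  · obtain ⟨ξ, hξ, h⟩ := exists_isPrimitiveRoot_lcm Finset.univ n T.pos
      (IntermediateField.normalClosure K L Ω) fun i => by
        obtain ⟨ξ, h⟩ := T.exists_primitive i
        refine ⟨ξ, ?_, h⟩
        obtain ⟨c, hc, h1, hirr⟩ := T.exists_pow i
        obtain ⟨g, hg⟩ := exists_algEquiv_apply_eq_mul (T.pos i) h1 hirr h.pow_eq_one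
        rw [← mul_div_cancel_right₀ ξ (T.α_ne_zero i), ← hg]
        refine div_mem ?_ (IntermediateField.le_normalClosure _ (T.α_mem i))
        rw [IntermediateField.normalClosure_def'']
        exact le_iSup (fun f : Ω ≃ₐ[K] Ω => L.map (f : Ω →ₐ[K] Ω)) g ⟨_, T.α_mem i, rfl⟩
    rw [← T.eq_lcm] at h
    refine IntermediateField.adjoin_le_iff.2 fun x hx => ?_
    obtain ⟨i, -, rfl⟩ := h.eq_pow_of_pow_eq_one hx.pow_eq_one
    exact pow_mem hξ i
  · rw [IntermediateField.normalClosure_def'']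
    refine iSup_le fun g => ?_
    nth_rewrite 1 [T.eq_adjoin]
    rw [IntermediateField.adjoin_map, IntermediateField.adjoin_le_iff]
    rintro _ ⟨_, ⟨i, rfl⟩, rfl⟩
    change g (α i) ∈ L ⊔ cyclo K Ω m
    rw [← div_mul_cancel₀ (g (α i)) (T.α_ne_zero i)]
    refine mul_mem (le_sup_right (a := L) (mem_cyclo hζ (T.pow_eq_one (i := i) ?_)))
      (le_sup_left (a := L) (T.α_mem i))
    obtain ⟨c, hc, h1, -⟩ := T.exists_pow i
    rw [div_pow, ← map_pow, h1, AlgEquiv.commutes, div_self]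
    rwa [Ne, map_eq_zero]

lemma linearDisjoint [IsGalois K Ω] : L.LinearDisjoint (cyclo K Ω m) := by
  have := T.neZero
  obtain ⟨ζ, hζ⟩ := T.exists_primitive'
  have := T.finiteDimensional
  have := finiteDimensional_cyclo (K := K) hζ
  exact (IntermediateField.LinearDisjoint.of_inf_eq_bot (inf_comm L _ ▸ T.inf_eq)).symm

lemma isGaloisComplement [IsGalois K Ω] : IsGaloisComplement L (cyclo K Ω m) :=
  ⟨isGalois_cyclo m, T.linearDisjoint, T.sup_cyclo⟩

/-- The basis of the monomials in the roots. -/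
lemma exists_basis : ∃ b : Basis (∀ i, Fin (n i)) K L,
    ∀ e, b e = ∏ i, (⟨α i, T.α_mem i⟩ : L) ^ (e i : ℕ) := by
  classical
  choose c hc hpow _ using T.exists_pow
  have h1 := (span_monomials_eq_top T.pos hpow T.eq_adjoin T.α_mem).ge
  refine ⟨basisOfTopLeSpanOfCardEqFinrank _ h1 ?_,
    fun e => congrFun (coe_basisOfTopLeSpanOfCardEqFinrank _ h1 _) e⟩
  rw [T.finrank_eq, Fintype.card_pi]
  simp

end KummerFamily

namespace KummerFamily

variable {K Ω : Type*} [Field K] [Field Ω] [Algebra K Ω] {ι : Type*} [Fintype ι]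
  {n : ι → ℕ} {α : ι → Ω} {m : ℕ} {L : IntermediateField K Ω} (T : KummerFamily n α m L)
include T

/-- The root `α i` as an element of the normal closure. -/
def root (i : ι) : IntermediateField.normalClosure K L Ω :=
  algebraMap L _ ⟨α i, T.α_mem i⟩

lemma root_ne_zero (i : ι) : T.root i ≠ 0 := fun h =>
  T.α_ne_zero i (congrArg Subtype.val h)

lemma exists_root_pow (i : ι) : ∃ c : K, c ≠ 0 ∧ T.root i ^ n i = algebraMap K _ c := by
  obtain ⟨c, hc, h, -⟩ := T.exists_pow i
  exact ⟨c, hc, Subtype.ext h⟩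

/-- The root of unity by which an automorphism multiplies `α i`. -/
def ratio (i : ι) (g : IntermediateField.normalClosure K L Ω ≃ₐ[K]
    IntermediateField.normalClosure K L Ω) : IntermediateField.normalClosure K L Ω :=
  g (T.root i) / T.root i

lemma apply_root (i : ι) (g : IntermediateField.normalClosure K L Ω ≃ₐ[K]
    IntermediateField.normalClosure K L Ω) : g (T.root i) = T.ratio i g * T.root i :=
  (div_mul_cancel₀ _ (T.root_ne_zero i)).symm

lemma ratio_pow (i : ι) (g : IntermediateField.normalClosure K L Ω ≃ₐ[K]
    IntermediateField.normalClosure K L Ω) : T.ratio i g ^ n i = 1 := by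
  obtain ⟨c, hc, h⟩ := T.exists_root_pow i
  rw [ratio, div_pow, ← map_pow, h, AlgEquiv.commutes, div_self]
  rwa [Ne, map_eq_zero]

omit T [Fintype ι] in
lemma mem_normalCompl_iff {M : IntermediateField K Ω}
    {σ : IntermediateField.normalClosure K L Ω ≃ₐ[K] IntermediateField.normalClosure K L Ω} :
    σ ∈ normalCompl L M ↔
      ∀ x : IntermediateField.normalClosure K L Ω, (x : Ω) ∈ M → σ x = x :=
  IntermediateField.mem_fixingSubgroup_iff _ _

lemma eq_on_of_apply_root_eq {g g' : IntermediateField.normalClosure K L Ω ≃ₐ[K]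
    IntermediateField.normalClosure K L Ω} (h : ∀ i, T.ratio i g = T.ratio i g') (x : L) :
    g (algebraMap L _ x) = g' (algebraMap L _ x) := by
  have h1 : g.toAlgHom.comp (IsScalarTower.toAlgHom K L _) =
      g'.toAlgHom.comp (IsScalarTower.toAlgHom K L _) := by
    refine IntermediateField.algHom_ext_of_eq_adjoin K T.eq_adjoin ?_
    rintro _ ⟨i, rfl⟩
    change g (T.root i) = g' (T.root i)
    rw [apply_root, apply_root, h]
  exact DFunLike.congr_fun h1 x

variable [IsGalois K Ω]

lemma ratio_mem (i : ι) (g : IntermediateField.normalClosure K L Ω ≃ₐ[K]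
    IntermediateField.normalClosure K L Ω) : (T.ratio i g : Ω) ∈ cyclo K Ω m := by
  have := T.neZero
  obtain ⟨ζ, hζ⟩ := T.exists_primitive'
  exact mem_cyclo hζ (T.pow_eq_one (congrArg Subtype.val (T.ratio_pow i g)))

lemma apply_ratio (i : ι) {σ : IntermediateField.normalClosure K L Ω ≃ₐ[K]
    IntermediateField.normalClosure K L Ω} (hσ : σ ∈ normalCompl L (cyclo K Ω m))
    (g : IntermediateField.normalClosure K L Ω ≃ₐ[K]
      IntermediateField.normalClosure K L Ω) : σ (T.ratio i g) = T.ratio i g :=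
  mem_normalCompl_iff.1 hσ _ (T.ratio_mem i g)

/-- The characters of the normal complement given by the roots `α i`. -/
def ratioHom (i : ι) : normalCompl L (cyclo K Ω m) →* IntermediateField.normalClosure K L Ω where
  toFun σ := T.ratio i σ
  map_one' := div_self (T.root_ne_zero i)
  map_mul' σ τ := by
    refine mul_right_cancel₀ (T.root_ne_zero i) ?_
    rw [← apply_root]
    change σ.1 (τ.1 (T.root i)) = _
    rw [apply_root, map_mul, T.apply_ratio i σ.2, apply_root, ← mul_assoc, mul_comm (T.ratio i τ.1)]

lemma apply_root_eq (i : ι) (σ : normalCompl L (cyclo K Ω m)) :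
    σ.1 (T.root i) = T.ratioHom i σ * T.root i := T.apply_root i σ

lemma ratioHom_pow (i : ι) (σ : normalCompl L (cyclo K Ω m)) : T.ratioHom i σ ^ n i = 1 :=
  T.ratio_pow i σ

lemma ext_of_ratioHom {σ τ : normalCompl L (cyclo K Ω m)}
    (h : ∀ i, T.ratioHom i σ = T.ratioHom i τ) : σ = τ := by
  have hE : IntermediateField.normalClosure K L Ω = IntermediateField.adjoin K
      (Set.range α ∪ {ζ : Ω | IsPrimitiveRoot ζ m}) := by
    rw [IntermediateField.adjoin_union, ← T.eq_adjoin, ← T.sup_cyclo]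
    rfl
  have h1 : σ.1.toAlgHom = τ.1.toAlgHom := by
    refine IntermediateField.algHom_ext_of_eq_adjoin K hE fun x hx => ?_
    rcases hx with ⟨i, rfl⟩ | hx
    · exact T.eq_on_of_apply_root_eq h ⟨α i, T.α_mem i⟩
    · have hx' : x ∈ cyclo K Ω m := IntermediateField.subset_adjoin K _ hx
      exact (mem_normalCompl_iff.1 σ.2 _ hx').trans (mem_normalCompl_iff.1 τ.2 _ hx').symm
  exact Subtype.ext (AlgEquiv.ext fun x => DFunLike.congr_fun h1 x)

lemma normalCompl_comm (σ τ : normalCompl L (cyclo K Ω m)) : σ * τ = τ * σ :=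
  T.ext_of_ratioHom fun i => by rw [map_mul, map_mul, mul_comm]

lemma exponent_normalCompl_dvd : Monoid.exponent (normalCompl L (cyclo K Ω m)) ∣ m :=
  Monoid.exponent_dvd_of_forall_pow_eq_one fun σ => T.ext_of_ratioHom fun i => by
    rw [map_pow, map_one, T.pow_eq_one (T.ratioHom_pow i σ)]

lemma cyclo_le : cyclo K Ω m ≤ IntermediateField.normalClosure K L Ω :=
  T.sup_cyclo ▸ le_sup_right

lemma finiteDimensional_normalClosure :
    FiniteDimensional K (IntermediateField.normalClosure K L Ω) := by
  have := T.finiteDimensional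
  infer_instance

/-- The field `K(ζ_m)` inside of the normal closure. -/
def comapCycloEquiv : (cyclo K Ω m).comap (IntermediateField.normalClosure K L Ω).val ≃ₐ[K]
    cyclo K Ω m :=
  (IntermediateField.equivMap _ (IntermediateField.normalClosure K L Ω).val).trans
    (IntermediateField.equivOfEq (IntermediateField.map_comap_eq_self
      (by rw [IntermediateField.fieldRange_val]; exact T.cyclo_le)))

lemma card_normalCompl : Nat.card (normalCompl L (cyclo K Ω m)) = ∏ i, n i := by
  have := T.neZero
  obtain ⟨ζ, hζ⟩ := T.exists_primitive'
  have := finiteDimensional_cyclo (K := K) hζ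
  have := T.finiteDimensional_normalClosure
  have h1 := T.linearDisjoint.finrank_sup
  rw [T.sup_cyclo, T.finrank_eq] at h1
  have h2 := finrank_mul_finrank K
    ((cyclo K Ω m).comap (IntermediateField.normalClosure K L Ω).val)
    (IntermediateField.normalClosure K L Ω)
  rw [T.comapCycloEquiv.toLinearEquiv.finrank_eq, h1, mul_comm] at h2
  rw [normalCompl, IsGalois.card_fixingSubgroup_eq_finrank]
  exact Nat.eq_of_mul_eq_mul_right finrank_pos h2

lemma normal_normalCompl : (normalCompl L (cyclo K Ω m)).Normal := by
  have : IsGalois K ((cyclo K Ω m).comap (IntermediateField.normalClosure K L Ω).val) :=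
    IsGalois.of_algEquiv T.comapCycloEquiv.symm
  exact IsGalois.fixingSubgroup_normal_of_isGalois _

lemma exists_ratioHom_eq (ζ : ι → IntermediateField.normalClosure K L Ω)
    (hζ : ∀ i, ζ i ^ n i = 1) :
    ∃ σ : normalCompl L (cyclo K Ω m), ∀ i, T.ratioHom i σ = ζ i := by
  have (i : ι) : NeZero (n i) := ⟨T.pos i⟩
  let f : normalCompl L (cyclo K Ω m) →
      ∀ i, rootsOfUnity (n i) (IntermediateField.normalClosure K L Ω) :=
    fun σ i => rootsOfUnity.mkOfPowEq (T.ratioHom i σ) (T.ratioHom_pow i σ)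
  have hf (σ) (i : ι) : ((f σ i : (IntermediateField.normalClosure K L Ω)ˣ) :
      IntermediateField.normalClosure K L Ω) = T.ratioHom i σ := rootsOfUnity.coe_mkOfPowEq _ 
  have h1 : Function.Injective f := fun σ τ h => T.ext_of_ratioHom fun i => by
    rw [← hf, ← hf, h]
  have h2 := h1.bijective_of_nat_card_le (by
    rw [T.card_normalCompl, Nat.card_pi]
    exact Finset.prod_le_prod' fun i _ => card_rootsOfUnity _ _)
  obtain ⟨σ, hσ⟩ := h2.2 fun i => rootsOfUnity.mkOfPowEq (ζ i) (hζ i)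
  exact ⟨σ, fun i => by rw [← hf, hσ, rootsOfUnity.coe_mkOfPowEq]⟩

lemma exists_primitive_normalClosure (i : ι) :
    ∃ ζ : IntermediateField.normalClosure K L Ω, IsPrimitiveRoot ζ (n i) := by
  have := T.neZero
  obtain ⟨ζ, h⟩ := T.exists_primitive i
  obtain ⟨ξ, hξ⟩ := T.exists_primitive'
  have h2 : ζ ∈ IntermediateField.normalClosure K L Ω :=
    T.cyclo_le (mem_cyclo hξ (T.pow_eq_one h.pow_eq_one))
  exact ⟨⟨ζ, h2⟩, IsPrimitiveRoot.of_map_of_injective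
    (f := (IntermediateField.normalClosure K L Ω).val) h Subtype.val_injective⟩

lemma algebraMap_monomial {b : Basis (∀ i, Fin (n i)) K L}
    (hb : ∀ e, b e = ∏ i, (⟨α i, T.α_mem i⟩ : L) ^ (e i : ℕ)) (e : ∀ i, Fin (n i)) :
    algebraMap L (IntermediateField.normalClosure K L Ω) (b e) = ∏ i, T.root i ^ (e i : ℕ) := by
  rw [hb, map_prod]
  simp only [map_pow]
  rfl

/-- The normal complement acts on the monomials through distinct characters. -/
def diagonalData (b : Basis (∀ i, Fin (n i)) K L)
    (hb : ∀ e, b e = ∏ i, (⟨α i, T.α_mem i⟩ : L) ^ (e i : ℕ)) :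
    DiagonalData (E := IntermediateField.normalClosure K L Ω) b
      (normalCompl L (cyclo K Ω m)) where
  χ e := ∏ i, T.ratioHom i ^ (e i : ℕ)
  χ_injective e e' h := funext fun i => by
    classical
    obtain ⟨ζ, hζ⟩ := T.exists_primitive_normalClosure i
    obtain ⟨σ, hσ⟩ := T.exists_ratioHom_eq (Pi.mulSingle i ζ) fun j => by
      rcases eq_or_ne j i with rfl | hj
      · rw [Pi.mulSingle_eq_same, hζ.pow_eq_one]
      · rw [Pi.mulSingle_eq_of_ne hj, one_pow]
    have h1 (e : ∀ i, Fin (n i)) : (∏ i, T.ratioHom i ^ (e i : ℕ)) σ = ζ ^ (e i : ℕ) := by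
      rw [MonoidHom.finsetProd_apply, Fintype.prod_eq_single i fun j hj => by
        rw [MonoidHom.pow_apply, hσ, Pi.mulSingle_eq_of_ne hj, one_pow]]
      rw [MonoidHom.pow_apply, hσ, Pi.mulSingle_eq_same]
    have h2 := DFunLike.congr_fun h σ
    rw [h1, h1] at h2
    exact Fin.ext (hζ.pow_inj (e i).2 (e' i).2 h2)
  apply_basis e σ := by
    rw [T.algebraMap_monomial hb, map_prod, MonoidHom.finsetProd_apply, ← Finset.prod_mul_distrib]
    refine Finset.prod_congr rfl fun i _ => ?_
    rw [map_pow, T.apply_root_eq, mul_pow, MonoidHom.pow_apply]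
  comm σ hσ τ hτ := congrArg Subtype.val (T.normalCompl_comm ⟨σ, hσ⟩ ⟨τ, hτ⟩)
  exists_eq g := by
    obtain ⟨σ, hσ⟩ := T.exists_ratioHom_eq (fun i => T.ratio i g) fun i => T.ratio_pow i g
    exact ⟨σ, σ.2, T.eq_on_of_apply_root_eq fun i => (hσ i).symm⟩
  eq_one σ hσ h := by
    refine congrArg Subtype.val (T.ext_of_ratioHom (σ := ⟨σ, hσ⟩) (τ := 1) fun i => ?_)
    rw [map_one]
    change σ (T.root i) / T.root i = 1
    rw [show σ (T.root i) = T.root i from h _, div_self (T.root_ne_zero i)]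
  normal := T.normal_normalCompl
  card_ne_zero := by
    rw [T.card_normalCompl, Nat.cast_prod]
    exact Finset.prod_ne_zero_iff.2 fun i _ => T.n_ne_zero i

end KummerFamily

/-- The sum of the `k`-th powers of all `n`-th roots of unity. -/
lemma sum_primitiveRoot_pow {F : Type*} [Field F] {n : ℕ} {ζ : F} (hζ : IsPrimitiveRoot ζ n)
    (k : ℕ) : ∑ s : Fin n, (ζ ^ (s : ℕ)) ^ k = if n ∣ k then (n : F) else 0 := by
  simp only [pow_right_comm ζ _ k]
  rw [Fin.sum_univ_eq_sum_range fun s => (ζ ^ k) ^ s]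
  split_ifs with h
  · rw [(hζ.pow_eq_one_iff_dvd k).2 h]
    simp
  · have h1 : ζ ^ k - 1 ≠ 0 := fun h2 => h ((hζ.pow_eq_one_iff_dvd k).1 (sub_eq_zero.1 h2))
    refine mul_left_cancel₀ h1 ?_
    rw [mul_geom_sum, pow_right_comm, hζ.pow_eq_one, one_pow, sub_self, mul_zero]

namespace KummerFamily

variable {R K Ω : Type*} [CommRing R] [Field K] [Algebra R K]
  [Field Ω] [Algebra K Ω] [Algebra R Ω] [IsScalarTower R K Ω] {ι : Type*} [Fintype ι]
  {n : ι → ℕ} {α : ι → Ω} {m : ℕ} {L : IntermediateField K Ω} (T : KummerFamily n α m L)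
  {a : ι → R} (ha : ∀ i, α i ^ n i = algebraMap R Ω (a i))
  {b : Basis (∀ i, Fin (n i)) K L}
  (hb : ∀ e, b e = ∏ i, (⟨α i, T.α_mem i⟩ : L) ^ (e i : ℕ))
include T ha

lemma isIntegral_root (i : ι) : IsIntegral R (α i) :=
  IsIntegral.of_pow (Nat.pos_of_ne_zero (T.pos i)) (by rw [ha]; exact isIntegral_algebraMap)

include hb

lemma mem_integralClosure_of_repr_mem {x : L} (h : ∀ e, b.repr x e ∈ (algebraMap R K).range) :
    x ∈ integralClosure R L := by
  classical
  rw [← b.sum_repr x]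
  refine sum_mem fun e _ => ?_
  obtain ⟨r, hr⟩ := h e
  rw [← hr, IsScalarTower.algebraMap_smul, hb]
  have h1 (i : ι) : (⟨α i, T.α_mem i⟩ : L) ∈ integralClosure R L :=
    (isIntegral_algHom_iff (L.val.restrictScalars R) Subtype.val_injective).1
      (T.isIntegral_root ha i)
  exact Subalgebra.smul_mem _ (prod_mem fun i _ => pow_mem (h1 i) _) r

variable [IsGalois K Ω]

/-- The relative trace to `K(α_i)` of the product of an integral element of `L` with a monomial
in the other roots. -/
lemma isIntegral_sum_update [DecidableEq ι] {x : L} (hx : x ∈ integralClosure R L) (i : ι)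
    (e : ∀ i, Fin (n i)) :
    IsIntegral R (∑ t : Fin (n i), algebraMap K Ω (b.repr x (Function.update e i t) *
      algebraMap R K (∏ j ∈ {i}ᶜ, a j * (n j : R))) * α i ^ (t : ℕ)) := by
  choose ζ hζ using T.exists_primitive_normalClosure
  choose σ hσ using fun s : ∀ j, Fin (n j) => T.exists_ratioHom_eq (fun j => ζ j ^ (s j : ℕ))
    fun j => by rw [← pow_mul, mul_comm, pow_mul, (hζ j).pow_eq_one, one_pow]
  let w (j : ι) : ℕ := if j = i then 0 else n j - e j
  let S (j : ι) : Finset (Fin (n j)) :=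
    if j = i then {⟨0, Nat.pos_of_ne_zero (T.pos j)⟩} else Finset.univ
  let y : IntermediateField.normalClosure K L Ω := algebraMap L _ x * ∏ j, T.root j ^ w j
  have hval {z : IntermediateField.normalClosure K L Ω} (hz : IsIntegral R (z : Ω)) :
      IsIntegral R z :=
    (isIntegral_algHom_iff ((IntermediateField.normalClosure K L Ω).val.restrictScalars R)
      Subtype.val_injective).1 hz
  have hroot (j : ι) : IsIntegral R (T.root j) := hval (T.isIntegral_root ha j)
  have hx' : IsIntegral R (algebraMap L (IntermediateField.normalClosure K L Ω) x) :=
    hval (IsIntegral.map (L.val.restrictScalars R) hx)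
  have hy : IsIntegral R y := hx'.mul
    (IsIntegral.prod _ fun j _ => (hroot j).pow _)
  have h1 : IsIntegral R (∑ s ∈ Fintype.piFinset S, (σ s).1 y) :=
    IsIntegral.sum _ fun s _ => hy.map ((σ s).1.toAlgHom.restrictScalars R)
  have hmon (e' : ∀ i, Fin (n i)) (s : ∀ i, Fin (n i)) :
      (σ s).1 (algebraMap L _ (b e') * ∏ j, T.root j ^ w j) =
        (∏ j, (ζ j ^ (s j : ℕ)) ^ (e' j + w j)) * ∏ j, T.root j ^ (e' j + w j) := by
    rw [T.algebraMap_monomial hb, ← Finset.prod_mul_distrib, map_prod, ← Finset.prod_mul_distrib]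
    refine Finset.prod_congr rfl fun j _ => ?_
    rw [← pow_add, map_pow, T.apply_root_eq, hσ, mul_pow]
  have hsum (e' : ∀ i, Fin (n i)) :
      ∑ s ∈ Fintype.piFinset S, ∏ j, (ζ j ^ (s j : ℕ)) ^ (e' j + w j) =
        ∏ j, if j = i then 1 else if e' j = e j then
          (n j : IntermediateField.normalClosure K L Ω) else 0 := by
    rw [← Finset.prod_univ_sum S fun j t => (ζ j ^ (t : ℕ)) ^ (e' j + w j)]
    refine Finset.prod_congr rfl fun j _ => ?_
    by_cases hj : j = i
    · simp [S, hj]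
    · simp only [S, w, if_neg hj, sum_primitiveRoot_pow (hζ j)]
      refine if_congr ⟨fun ⟨d, hd⟩ => ?_, fun h => ?_⟩ rfl rfl
      · have := (e j).2
        have := (e' j).2
        have hd0 : d = 1 := by
          have h2 : 0 < n j * d := by omega
          have h3 : n j * d < n j * 2 := by omega
          have := Nat.pos_of_mul_pos_left h2
          have := Nat.lt_of_mul_lt_mul_left h3
          omega
        rw [hd0] at hd
        exact Fin.ext (by omega)
      · rw [h, Nat.add_sub_cancel' (e j).2.le]
  have h2 : ∑ s ∈ Fintype.piFinset S, (σ s).1 y = ∑ t : Fin (n i),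
      algebraMap K _ (b.repr x (Function.update e i t) *
        algebraMap R K (∏ j ∈ {i}ᶜ, a j * (n j : R))) * T.root i ^ (t : ℕ) := by
    have h3 (s : ∀ i, Fin (n i)) : (σ s).1 y = ∑ e', algebraMap K _ (b.repr x e') *
        ((∏ j, (ζ j ^ (s j : ℕ)) ^ (e' j + w j)) * ∏ j, T.root j ^ (e' j + w j)) := by
      simp only [← hmon, y]
      conv_lhs => rw [← b.sum_repr x]
      rw [map_sum, Finset.sum_mul, map_sum]
      refine Finset.sum_congr rfl fun e' _ => ?_
      rw [Algebra.smul_def, map_mul (algebraMap L _), mul_assoc, map_mul,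
        ← IsScalarTower.algebraMap_apply K L, AlgEquiv.commutes]
    simp only [h3]
    rw [Finset.sum_comm]
    simp only [← Finset.mul_sum, ← Finset.sum_mul, hsum]
    refine (Fintype.sum_of_injective (Function.update e i) (Function.update_injective e i) _ _
      (fun e' he' => ?_) fun t => ?_).symm
    · have h4 : ∃ j, j ≠ i ∧ e' j ≠ e j := by
        by_contra! h4
        refine he' ⟨e' i, funext fun j => ?_⟩
        rcases eq_or_ne j i with rfl | hj
        · rw [Function.update_self]
        · rw [Function.update_of_ne hj, h4 j hj]
      obtain ⟨j, hj, hje⟩ := h4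
      rw [Finset.prod_eq_zero (Finset.mem_univ j) (by rw [if_neg hj, if_neg hje]), zero_mul,
        mul_zero]
    · rw [map_mul, mul_assoc, ← Finset.prod_mul_distrib, Fintype.prod_eq_mul_prod_compl i]
      congr 1
      rw [mul_comm]
      congr 1
      · simp [w]
      · rw [map_prod, map_prod]
        refine Finset.prod_congr rfl fun j hj => ?_
        have hj' : j ≠ i := by simpa using hj
        have h5 : T.root j ^ n j = algebraMap K _ (algebraMap R K (a j)) := by
          refine Subtype.ext ((ha j).trans ?_)
          rw [IsScalarTower.algebraMap_apply R K Ω]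
          rfl
        simp only [w, if_neg hj', Function.update_of_ne hj', if_true,
          Nat.add_sub_cancel' (e j).2.le, h5, map_mul, map_natCast]
        rw [mul_comm]
  rw [h2] at h1
  have h3 := h1.map ((IntermediateField.normalClosure K L Ω).val.restrictScalars R)
  convert! h3 using 1
  simp only [map_sum, map_mul]
  rfl

lemma mem_integralClosure_iff [IsDomain R] [IsIntegrallyClosed R] [IsFractionRing R K]
    (hcop : Pairwise fun i j => IsCoprime (a i * (n i : R)) (a j * (n j : R)))
    (hint : ∀ i, ∀ c : Fin (n i) → K, IsIntegral R (∑ t, algebraMap K Ω (c t) * α i ^ (t : ℕ)) →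
      ∀ t, c t ∈ (algebraMap R K).range) (x : L) :
    x ∈ integralClosure R L ↔ ∀ e, b.repr x e ∈ (algebraMap R K).range := by
  classical
  refine ⟨fun hx e => ?_, T.mem_integralClosure_of_repr_mem ha hb⟩
  rcases isEmpty_or_nonempty ι with hι | hι
  · have h1 : x = algebraMap K L (b.repr x e) := by
      conv_lhs => rw [← b.sum_repr x]
      rw [Fintype.sum_subsingleton _ e, hb, Fintype.prod_empty, Algebra.algebraMap_eq_smul_one]
    have h2 : IsIntegral R (algebraMap K L (b.repr x e)) := h1 ▸ hx
    exact IsIntegrallyClosed.isIntegral_iff.1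
      ((isIntegral_algebraMap_iff (algebraMap K L).injective).1 h2)
  · obtain ⟨μ, hμ⟩ := exists_sum_eq_one_iff_pairwise_coprime'.2 hcop
    have h1 (i : ι) : b.repr x e * algebraMap R K (∏ j ∈ {i}ᶜ, a j * (n j : R)) ∈
        (algebraMap R K).range := by
      have := hint i _ (T.isIntegral_sum_update ha hb hx i e) (e i)
      rwa [Function.update_eq_self] at this
    have h2 : b.repr x e = ∑ i, algebraMap R K (μ i) *
        (b.repr x e * algebraMap R K (∏ j ∈ {i}ᶜ, a j * (n j : R))) := by
      have h3 := congrArg (fun r => b.repr x e * algebraMap R K r) hμ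
      simp only [map_sum, map_one, mul_one, Finset.mul_sum] at h3
      exact h3.symm.trans (Finset.sum_congr rfl fun i _ => by rw [map_mul, mul_left_comm])
    rw [h2]
    exact sum_mem fun i _ => mul_mem ⟨μ i, rfl⟩ (h1 i)

end KummerFamily

/-- A tensor product of algebras of functions on finite sets is the algebra of the functions on
the product. -/
def piTensorFunHom {S : Type*} [CommRing S] {ι I : Type*} [Fintype ι] {κ : ι → Type*}
    {A : ι → Type*} [∀ i, Semiring (A i)] [∀ i, Algebra S (A i)] (θ : ∀ i, A i ≃ₐ[S] (κ i → S))
    (ε : I ≃ ∀ i, κ i) : (⨂[S] i, A i) →ₐ[S] (I → S) :=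
  PiTensorProduct.liftAlgHom
    (MultilinearMap.pi fun e => (MultilinearMap.mkPiAlgebra S ι S).compLinearMap fun i =>
      (LinearMap.proj (ε e i)).comp (θ i).toLinearMap)
    (by ext e; simp) (fun x y => by ext e; simp [Finset.prod_mul_distrib])

lemma piTensorFunHom_tprod {S : Type*} [CommRing S] {ι I : Type*} [Fintype ι] {κ : ι → Type*}
    {A : ι → Type*} [∀ i, Semiring (A i)] [∀ i, Algebra S (A i)] (θ : ∀ i, A i ≃ₐ[S] (κ i → S))
    (ε : I ≃ ∀ i, κ i) (h : ∀ i, A i) (e : I) :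
    piTensorFunHom θ ε (PiTensorProduct.tprod S h) e = ∏ i, θ i (h i) (ε e i) := by
  simp [piTensorFunHom, PiTensorProduct.liftAlgHom]

lemma piTensorFunHom_bijective {S : Type*} [CommRing S] {ι I : Type*} [Fintype ι]
    {κ : ι → Type*} [∀ i, Finite (κ i)]
    {A : ι → Type*} [∀ i, Semiring (A i)] [∀ i, Algebra S (A i)] (θ : ∀ i, A i ≃ₐ[S] (κ i → S))
    (ε : I ≃ ∀ i, κ i) : Function.Bijective (piTensorFunHom θ ε) := by
  classical
  have (i : ι) := Fintype.ofFinite (κ i)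
  have : Finite I := Finite.of_equiv _ ε.symm
  let B : ∀ i, Basis (κ i) S (A i) := fun i => (Pi.basisFun S (κ i)).map (θ i).symm.toLinearEquiv
  have h : (piTensorFunHom θ ε).toLinearMap =
      (((Basis.piTensorProduct B).reindex ε.symm).equiv (Pi.basisFun S I)
        (Equiv.refl I)).toLinearMap := by
    refine ((Basis.piTensorProduct B).reindex ε.symm).ext fun e => funext fun e' => ?_
    rw [LinearEquiv.coe_coe, Basis.equiv_apply, Basis.reindex_apply, Equiv.symm_symm,
      Basis.piTensorProduct_apply, AlgHom.toLinearMap_apply, piTensorFunHom_tprod,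
      Equiv.refl_apply, Pi.basisFun_apply]
    have hB (i : ι) (k : κ i) : θ i (B i k) = Pi.single k 1 := by
      simp only [B, Basis.map_apply, Pi.basisFun_apply]
      exact (θ i).apply_symm_apply _
    simp only [hB, Pi.single_apply]
    rw [Fintype.prod_ite_zero]
    simp only [Finset.prod_const_one, ← funext_iff, ε.injective.eq_iff]
  have h2 : ⇑(piTensorFunHom θ ε) = (((Basis.piTensorProduct B).reindex ε.symm).equiv
      (Pi.basisFun S I) (Equiv.refl I)) := congrArg DFunLike.coe h
  rw [h2]
  exact LinearEquiv.bijective _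

/-- A tensor product of algebras of functions on finite sets is the algebra of the functions on
the product. -/
def piTensorFunEquiv {S : Type*} [CommRing S] {ι I : Type*} [Fintype ι] {κ : ι → Type*}
    [∀ i, Finite (κ i)]
    {A : ι → Type*} [∀ i, Semiring (A i)] [∀ i, Algebra S (A i)] (θ : ∀ i, A i ≃ₐ[S] (κ i → S))
    (ε : I ≃ ∀ i, κ i) : (⨂[S] i, A i) ≃ₐ[S] (I → S) :=
  AlgEquiv.ofBijective (piTensorFunHom θ ε) (piTensorFunHom_bijective θ ε)

lemma piTensorFunEquiv_tprod {S : Type*} [CommRing S] {ι I : Type*} [Fintype ι] {κ : ι → Type*}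
    [∀ i, Finite (κ i)]
    {A : ι → Type*} [∀ i, Semiring (A i)] [∀ i, Algebra S (A i)] (θ : ∀ i, A i ≃ₐ[S] (κ i → S))
    (ε : I ≃ ∀ i, κ i) (h : ∀ i, A i) (e : I) :
    piTensorFunEquiv θ ε (PiTensorProduct.tprod S h) e = ∏ i, θ i (h i) (ε e i) :=
  piTensorFunHom_tprod θ ε h e

lemma exists_piTensor_algEquiv {S : Type*} [CommRing S] {ι I : Type*} [Fintype ι]
    {κ : ι → Type*} [∀ i, Finite (κ i)] {A : ι → Type*} [∀ i, Semiring (A i)]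
    [∀ i, Algebra S (A i)] {B : Type*} [Semiring B] [Algebra S B]
    (θ : ∀ i, A i ≃ₐ[S] (κ i → S)) (θ' : B ≃ₐ[S] (I → S)) (ε : I ≃ ∀ i, κ i) :
    ∃ Ψ : (⨂[S] i, A i) ≃ₐ[S] B, ∀ (h : ∀ i, A i) (e : I),
      θ' (Ψ (PiTensorProduct.tprod S h)) e = ∏ i, θ i (h i) (ε e i) :=
  ⟨(piTensorFunEquiv θ ε).trans θ'.symm, fun h e => by
    rw [AlgEquiv.trans_apply, AlgEquiv.apply_symm_apply, piTensorFunEquiv_tprod]⟩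

lemma finrank_adjoin_eq_prod_of_coprime {K Ω : Type*} [Field K] [Field Ω] [Algebra K Ω]
    {ι : Type*} [Fintype ι] {n : ι → ℕ}
    (hn : ∀ i, n i ≠ 0) {α : ι → Ω} {c : ι → K} (hα : ∀ i, α i ^ n i = algebraMap K Ω (c i))
    (hirr : ∀ i, Irreducible (Polynomial.X ^ n i - Polynomial.C (c i) : Polynomial K))
    {L : IntermediateField K Ω} (hL : L = IntermediateField.adjoin K (Set.range α))
    (hcop : ∀ i j, i ≠ j → (n i).Coprime (n j)) : finrank K L = ∏ i, n i := by
  classical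
  have hint (i : ι) : IsIntegral K (α i) := IsIntegral.of_pow (Nat.pos_of_ne_zero (hn i))
    (by rw [hα]; exact isIntegral_algebraMap)
  have : FiniteDimensional K L := by
    rw [hL]
    exact IntermediateField.finiteDimensional_adjoin (by rintro _ ⟨i, rfl⟩; exact hint i)
  have hmem (i : ι) : α i ∈ L := hL ▸ IntermediateField.subset_adjoin _ _ ⟨i, rfl⟩
  refine le_antisymm ?_ (Nat.le_of_dvd finrank_pos ?_)
  · have h1 := finrank_range_le_card (R := K) fun e : ∀ i, Fin (n i) =>
      ∏ i, (⟨α i, hmem i⟩ : L) ^ (e i : ℕ)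
    rw [Set.finrank, span_monomials_eq_top hn hα hL hmem, finrank_top, Fintype.card_pi] at h1
    simpa using h1
  · refine Finset.prod_dvd_of_isRelPrime (fun i _ j _ hij =>
      Nat.coprime_iff_isRelPrime.1 (hcop i j hij)) fun i _ => ?_
    have h2 : finrank K (IntermediateField.adjoin K {α i}) = n i := by
      rw [IntermediateField.adjoin.finrank (hint i),
        minpoly_eq_of_irreducible (hn i) (hα i) (hirr i), Polynomial.natDegree_X_pow_sub_C]
    rw [← h2]
    exact IntermediateField.finrank_dvd_of_le_right
      (IntermediateField.adjoin_simple_le_iff.2 (hmem i))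

lemma kummerFamily_single {K Ω : Type*} [Field K] [Field Ω] [Algebra K Ω] {n : ℕ}
    (hn : (n : K) ≠ 0) {α : Ω} {c : K} (hc : c ≠ 0) (hα : α ^ n = algebraMap K Ω c)
    (hirr : Irreducible (Polynomial.X ^ n - Polynomial.C c : Polynomial K))
    {L : IntermediateField K Ω} (hL : L = IntermediateField.adjoin K {α})
    (hinf : L ⊓ cyclo K Ω n = ⊥) :
    KummerFamily (fun _ : Unit => n) (fun _ : Unit => α) n L where
  eq_lcm := by simp
  ne_zero := hn
  exists_pow _ := ⟨c, hc, hα, hirr⟩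
  eq_adjoin := by rw [hL, Set.range_const]
  inf_eq := hinf
  finrank_eq := finrank_adjoin_eq_prod_of_coprime (c := fun _ => c)
    (fun _ h => hn (by rw [h, Nat.cast_zero])) (fun _ => hα) (fun _ => hirr)
    (by rw [hL, Set.range_const]) fun i j h => (h (Subsingleton.elim i j)).elim

namespace KummerFamily

variable {K Ω : Type*} [Field K] [Field Ω] [Algebra K Ω] [IsGalois K Ω] {ι : Type*} [Fintype ι]
  {n : ι → ℕ} {α : ι → Ω} {m : ℕ} {L : IntermediateField K Ω} (T : KummerFamily n α m L)
  {b : Basis (∀ i, Fin (n i)) K L}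
  (hb : ∀ e, b e = ∏ i, (⟨α i, T.α_mem i⟩ : L) ^ (e i : ℕ))

/-- The almost classically Galois structure consists of the endomorphisms that are diagonal in
the basis of monomials. -/
def hopfEquiv : acHopf L (cyclo K Ω m) ≃ₐ[K] ((∀ i, Fin (n i)) → K) :=
  (T.diagonalData b hb).eigenEquiv

lemma repr_smul (h : acHopf L (cyclo K Ω m)) (x : L) (e : ∀ i, Fin (n i)) :
    b.repr (h • x) e = T.hopfEquiv hb h e * b.repr x e :=
  (T.diagonalData b hb).repr_smul h x e

variable {R : Type*} [CommRing R] [Algebra R K] [Algebra R Ω] [IsScalarTower R K Ω]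
  (hO : ∀ x : L, x ∈ integralClosure R L ↔ ∀ e, b.repr x e ∈ (algebraMap R K).range)

/-- The associated order consists of the endomorphisms that are diagonal in the basis of monomials
with entries in `R`. -/
def orderEquiv [FaithfulSMul R K] : acOrder R L (cyclo K Ω m) ≃ₐ[R] ((∀ i, Fin (n i)) → R) :=
  (T.diagonalData b hb).orderEquiv hO

lemma algebraMap_orderEquiv [FaithfulSMul R K] (h : acOrder R L (cyclo K Ω m))
    (e : ∀ i, Fin (n i)) :
    algebraMap R K (T.orderEquiv hb hO h e) = T.hopfEquiv hb (h : acHopf L (cyclo K Ω m)) e :=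
  (T.diagonalData b hb).algebraMap_orderEquiv hO h e

include T hb hO in
lemma free_acOrder : Module.Free (acOrder R L (cyclo K Ω m)) (integralClosure R L) :=
  (T.diagonalData b hb).free_assocOrder hO

end KummerFamily

lemma single_mem_integralClosure_iff {R K Ω : Type*} [CommRing R] [IsDomain R]
    [Field K] [Algebra R K] [IsFractionRing R K]
    [Field Ω] [Algebra K Ω] [Algebra R Ω] [IsScalarTower R K Ω] {n : ℕ} {α : Ω} {a : R}
    (ha : α ^ n = algebraMap R Ω a) {L : IntermediateField K Ω}
    (T : KummerFamily (fun _ : Unit => n) (fun _ : Unit => α) n L)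
    (hint : integralClosure R L = Algebra.adjoin R {x : L | (x : Ω) = α})
    {b : Basis (Unit → Fin n) K L}
    (hb : ∀ e, b e = ∏ i, (⟨α, T.α_mem i⟩ : L) ^ (e i : ℕ)) (x : L) :
    x ∈ integralClosure R L ↔ ∀ e, b.repr x e ∈ (algebraMap R K).range := by
  refine ⟨fun hx => ?_, T.mem_integralClosure_of_repr_mem (fun _ => ha) hb⟩
  have h1 : {x : L | (x : Ω) = α} = Set.range fun i : Unit => (⟨α, T.α_mem i⟩ : L) := by
    ext y
    simp [Subtype.ext_iff, eq_comm]
  rw [hint, h1] at hx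
  have h2 := adjoin_le_span_monomials T.pos (c := fun _ => a) (fun i => Subtype.ext ha) hx
  simp only [← hb] at h2
  exact (b.mem_span_iff_repr_mem R x).1 h2

lemma repr_mem_of_isIntegral {R K Ω : Type*} [CommRing R]
    [Field K] [Algebra R K]
    [Field Ω] [Algebra K Ω] [Algebra R Ω] [IsScalarTower R K Ω] {n : ℕ} {α : Ω}
    {L : IntermediateField K Ω}
    (T : KummerFamily (fun _ : Unit => n) (fun _ : Unit => α) n L)
    {b : Basis (Unit → Fin n) K L}
    (hb : ∀ e, b e = ∏ i, (⟨α, T.α_mem i⟩ : L) ^ (e i : ℕ))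
    (hO : ∀ x : L, x ∈ integralClosure R L ↔ ∀ e, b.repr x e ∈ (algebraMap R K).range)
    (c : Fin n → K) (hc : IsIntegral R (∑ t, algebraMap K Ω (c t) * α ^ (t : ℕ))) (t : Fin n) :
    c t ∈ (algebraMap R K).range := by
  let z : L := ∑ e : Unit → Fin n, c (e ()) • b e
  have hz : (z : Ω) = ∑ t, algebraMap K Ω (c t) * α ^ (t : ℕ) := by
    change L.val z = _
    rw [map_sum]
    refine Fintype.sum_equiv (Equiv.funUnique Unit (Fin n)) _ _ fun e => ?_
    rw [map_smul, hb, Algebra.smul_def]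
    simp
  have h1 : z ∈ integralClosure R L :=
    (isIntegral_algHom_iff (L.val.restrictScalars R) Subtype.val_injective).1
      (show IsIntegral R (z : Ω) by rwa [hz])
  have h2 := (hO z).1 h1 fun _ => t
  rwa [b.repr_sum_self] at h2

/-- Multiplying the expansions with respect to the bases of powers gives the expansion with
respect to the basis of monomials. -/
lemma prod_eq_sum_monomials {K Ω : Type*} [Field K] [Field Ω] [Algebra K Ω]
    {ι : Type*} [Fintype ι] [DecidableEq ι] {n : ι → ℕ} {α : ι → Ω} {m : ℕ}
    {L : IntermediateField K Ω}
    (T : KummerFamily n α m L) {b : Basis (∀ i, Fin (n i)) K L}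
    (hb : ∀ e, b e = ∏ i, (⟨α i, T.α_mem i⟩ : L) ^ (e i : ℕ))
    {Li : ι → IntermediateField K Ω}
    (Ti : ∀ i, KummerFamily (fun _ : Unit => n i) (fun _ : Unit => α i) (n i) (Li i))
    {bi : ∀ i, Basis (Unit → Fin (n i)) K (Li i)}
    (hbi : ∀ i e, bi i e = ∏ j, (⟨α i, (Ti i).α_mem j⟩ : Li i) ^ (e j : ℕ))
    (x : ∀ i, Li i) :
    ∏ i, (x i : Ω) = ((∑ e, (∏ i, (bi i).repr (x i) fun _ => e i) • b e : L) : Ω) := by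
  have h1 (i : ι) : (x i : Ω) =
      ∑ t : Fin (n i), algebraMap K Ω ((bi i).repr (x i) fun _ => t) * α i ^ (t : ℕ) := by
    conv_lhs => rw [← (bi i).sum_repr (x i)]
    change (Li i).val _ = _
    rw [map_sum]
    refine Fintype.sum_equiv (Equiv.funUnique Unit (Fin (n i))) _ _ fun e => ?_
    rw [map_smul, hbi, Algebra.smul_def]
    simp only [Finset.univ_unique, Finset.prod_singleton, map_pow]
    rfl
  simp only [h1]
  rw [Finset.prod_univ_sum]
  change _ = L.val _
  rw [map_sum, Fintype.piFinset_univ]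
  refine Finset.sum_congr rfl fun e _ => ?_
  rw [map_smul, hb, Algebra.smul_def, map_prod, map_prod, Finset.prod_mul_distrib]
  rfl

end HopfGalois

set_option maxHeartbeats 1000000 in
open HopfGalois in
theorem mainTheorem9
    {R K Ω : Type*} [CommRing R] [IsDomain R] [IsPrincipalIdealRing R]
    [Field K] [Algebra R K] [IsFractionRing R K]
    [Field Ω] [Algebra K Ω] [IsGalois K Ω] [Algebra R Ω] [IsScalarTower R K Ω]
    (k : ℕ) (n : Fin k → ℕ) (a : Fin k → R) (α : Fin k → Ω)
    (m : ℕ) (hm : m = Finset.univ.lcm n)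
    -- the characteristic of `K` is coprime to the least common multiple `m` of the `n i`
    (hchar : (m : K) ≠ 0)
    -- `α i` is an `n i`-th root of `a i`, of degree `n i` over `K`
    (ha : ∀ i, a i ≠ 0)
    (hα : ∀ i, α i ^ n i = algebraMap R Ω (a i))
    (hirr : ∀ i, Irreducible
      (Polynomial.X ^ n i - Polynomial.C (algebraMap R K (a i)) : Polynomial K))
    -- the fields `L_i = K(α_i)` and `L = K(α_1, …, α_k)`
    (Li : Fin k → IntermediateField K Ω) (hLi : ∀ i, Li i = IntermediateField.adjoin K {α i})
    (L : IntermediateField K Ω) (hL : L = IntermediateField.adjoin K (Set.range α))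
    -- `L_i ∩ K(ζ_{n_i}) = K` and `L ∩ K(ζ_m) = K`
    (hinf : ∀ i, Li i ⊓ cyclo K Ω (n i) = ⊥)
    (hinf' : L ⊓ cyclo K Ω m = ⊥)
    -- the `L_i` are pairwise strongly disjoint
    (hdisj : ∀ i j, i ≠ j →
      StronglyDisjoint (Li i) (cyclo K Ω (n i)) (Li j) (cyclo K Ω (n j)))
    -- `[L : K]` is the product of the `n i` (nothing is required if these are pairwise coprime)
    (hdeg : (∃ i j, i ≠ j ∧ ¬ (n i).Coprime (n j)) → Module.finrank K L = ∏ i, n i)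
    -- the elements `a_i n_i` are pairwise coprime in `R = O_K`
    (hcop : ∀ i j, i ≠ j → IsCoprime (a i * (n i : R)) (a j * (n j : R)))
    -- `O_{L_i} = O_K[α_i]`
    (hint : ∀ i, integralClosure R (Li i) = Algebra.adjoin R {x : Li i | (x : Ω) = α i}) :
    -- `K(ζ_{n_i})` and `K(ζ_m)` are Galois complements of `L_i / K` and `L / K`
    (∀ i, IsGaloisComplement (Li i) (cyclo K Ω (n i))) ∧
    IsGaloisComplement L (cyclo K Ω m) ∧
    -- `L / K` is almost Kummer with respect to `m`
    ((∀ σ ∈ normalCompl L (cyclo K Ω m), ∀ τ ∈ normalCompl L (cyclo K Ω m), σ * τ = τ * σ) ∧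
      Monoid.exponent (normalCompl L (cyclo K Ω m)) ∣ m) ∧
    -- `H = ⨂ H_i`, compatibly with the actions, and under this identification `𝔄_H = ⨂ 𝔄_{H_i}`
    (∃ Ψ : (⨂[K] i, acHopf (Li i) (cyclo K Ω (n i))) ≃ₐ[K] acHopf L (cyclo K Ω m),
      (∀ (h : ∀ i, acHopf (Li i) (cyclo K Ω (n i))) (x : ∀ i, Li i) (y : L),
        (y : Ω) = ∏ i, (x i : Ω) →
          ((Ψ (PiTensorProduct.tprod K h) • y : L) : Ω) = ∏ i, ((h i • x i : Li i) : Ω)) ∧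
      ∃ Φ : (⨂[R] i, acOrder R (Li i) (cyclo K Ω (n i))) ≃ₐ[R] acOrder R L (cyclo K Ω m),
        ∀ h : ∀ i, acOrder R (Li i) (cyclo K Ω (n i)),
          (Φ (PiTensorProduct.tprod R h) : acHopf L (cyclo K Ω m)) =
            Ψ (PiTensorProduct.tprod K
              fun i => (h i : acHopf (Li i) (cyclo K Ω (n i))))) ∧
    -- `O_L` is free over `𝔄_H`
    Module.Free (acOrder R L (cyclo K Ω m)) (integralClosure R L) := by

  classical
  have hn (i : Fin k) : (n i : K) ≠ 0 := fun h => hchar (by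
    obtain ⟨d, hd⟩ : n i ∣ m := hm ▸ Finset.dvd_lcm (Finset.mem_univ i)
    rw [hd, Nat.cast_mul, h, zero_mul])
  have hn0 (i : Fin k) : n i ≠ 0 := fun h => hn i (by rw [h, Nat.cast_zero])
  have ha' (i : Fin k) : algebraMap R K (a i) ≠ 0 :=
    (map_ne_zero_iff _ (IsFractionRing.injective R K)).2 (ha i)
  have hα' (i : Fin k) : α i ^ n i = algebraMap K Ω (algebraMap R K (a i)) := by
    rw [hα, IsScalarTower.algebraMap_apply R K Ω]
  have T : KummerFamily n α m L :=
    { eq_lcm := hm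
      ne_zero := hchar
      exists_pow := fun i => ⟨_, ha' i, hα' i, hirr i⟩
      eq_adjoin := hL
      inf_eq := hinf'
      finrank_eq := by
        by_cases h : ∃ i j, i ≠ j ∧ ¬ (n i).Coprime (n j)
        · exact hdeg h
        · push Not at h
          exact finrank_adjoin_eq_prod_of_coprime hn0 hα' hirr hL h }
  have Ti (i : Fin k) : KummerFamily (fun _ : Unit => n i) (fun _ : Unit => α i) (n i) (Li i) :=
    kummerFamily_single (hn i) (ha' i) (hα' i) (hirr i) (hLi i) (hinf i)
  obtain ⟨b, hb⟩ := T.exists_basis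
  choose bi hbi using fun i => (Ti i).exists_basis
  have hOi (i : Fin k) := single_mem_integralClosure_iff (hα i) (Ti i) (hint i) (hbi i)
  have hO := T.mem_integralClosure_iff hα hb (fun i j hij => hcop i j hij)
    fun i => repr_mem_of_isIntegral (Ti i) (hbi i) (hOi i)
  let ε : (∀ i, Fin (n i)) ≃ ∀ i, Unit → Fin (n i) :=
    Equiv.piCongrRight fun i => (Equiv.funUnique Unit (Fin (n i))).symm
  obtain ⟨Ψ, hΨ⟩ : ∃ Ψ : (⨂[K] i, acHopf (Li i) (cyclo K Ω (n i))) ≃ₐ[K] acHopf L (cyclo K Ω m),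
      ∀ h e, T.hopfEquiv hb (Ψ (PiTensorProduct.tprod K h)) e =
        ∏ i, (Ti i).hopfEquiv (hbi i) (h i) fun _ => e i :=
    exists_piTensor_algEquiv (A := fun i => acHopf (Li i) (cyclo K Ω (n i)))
      (fun i => (Ti i).hopfEquiv (hbi i)) (T.hopfEquiv hb) ε
  obtain ⟨Φ, hΦ⟩ : ∃ Φ : (⨂[R] i, acOrder R (Li i) (cyclo K Ω (n i))) ≃ₐ[R]
      acOrder R L (cyclo K Ω m), ∀ h e, T.orderEquiv hb hO (Φ (PiTensorProduct.tprod R h)) e =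
        ∏ i, (Ti i).orderEquiv (hbi i) (hOi i) (h i) fun _ => e i :=
    exists_piTensor_algEquiv (A := fun i => acOrder R (Li i) (cyclo K Ω (n i)))
      (fun i => (Ti i).orderEquiv (hbi i) (hOi i)) (T.orderEquiv hb hO) ε
  refine ⟨fun i => (Ti i).isGaloisComplement, T.isGaloisComplement,
    ⟨fun σ hσ τ hτ => congrArg Subtype.val (T.normalCompl_comm ⟨σ, hσ⟩ ⟨τ, hτ⟩),
      T.exponent_normalCompl_dvd⟩, ⟨Ψ, fun h x y hy => ?_, Φ, fun h => ?_⟩,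
    T.free_acOrder hb hO⟩
  · rw [prod_eq_sum_monomials T hb Ti hbi] at hy ⊢
    congr 1
    rw [← b.sum_repr (Ψ (PiTensorProduct.tprod K h) • y)]
    refine Finset.sum_congr rfl fun e _ => ?_
    congr 1
    rw [T.repr_smul hb, hΨ, Subtype.ext hy, b.repr_sum_self, ← Finset.prod_mul_distrib]
    exact Finset.prod_congr rfl fun i _ => ((Ti i).repr_smul (hbi i) _ _ _).symm
  · refine (T.hopfEquiv hb).injective (funext fun e => ?_)
    rw [hΨ, ← T.algebraMap_orderEquiv hb hO]
    rw [hΦ, map_prod]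
    exact Finset.prod_congr rfl fun i _ => (Ti i).algebraMap_orderEquiv (hbi i) (hOi i) _ _

end
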